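/- For a real random variable $X$ put $\|X\|_{\psi_2}=\inf\{t>0:\mathbb E[\exp(X^2/t^2)]\le 2\}$ (with $\inf\emptyset=\infty$), and call $X$ sub-Gaussian if $\|X\|_{\psi_2}<\infty$. For $r\in[1,\infty]$ let $\|\cdot\|_r$ be the $\ell_r$ norm on $\mathbb R^m$, let $B_r^m=\{z\in\mathbb R^m:\|z\|_r\le 1\}$, and for $S\subseteq\mathbb R^m$ let $\operatorname{rad}(S)=\sup_{z\in S}\|z\|_2$. **Theorem.** For every $1\le p<\infty$, with Hölder conjugate $q\in(1,\infty]$ (that is, $\frac1p+\frac1q=1$), there is a constant $C_p>0$ depending only on $p$ such that the following holds. Let $m,n\ge 1$, let $A$ be an $m\times n$ random matrix with i.i.d. mean-zero, unit-variance, sub-Gaussian entries, and let $K=\|A_{1,1}\|_{\psi_2}$. Let $A_1$ be the first row of $A$, let $\|A_1x\|_{L^p}=\mathbb E[|A_1x|^p]^{1/p}$, and for $x\in\mathbb R^n$ define $$R_x=\|Ax\|_p-m^{1/p}\|A_1x\|_{L^p},\qquad X_x=\|Ax\|_p-\mathbb E\big[\|Ax\|_p\big].$$ Then, for all $x,y\in\mathbb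 R^n$, $$\|R_x-R_y\|_{\psi_2}\le C_pK^{4p+4}\operatorname{rad}(B_q^m)\,\|x-y\|_2\quad\text{and}\quad\|X_x-X_y\|_{\psi_2}\le C_pK^{4p+4}\operatorname{rad}(B_q^m)\,\|x-y\|_2 .$$ -/

import Mathlib

open MeasureTheory ProbabilityTheory
open scoped ENNReal Matrix

noncomputable section

/-- The `α`-Orlicz norm `‖X‖_{ψ_α} = inf {t > 0 : E[exp(|X|^α / t^α)] ≤ 2}`, with values in
`[0, ∞]` and `inf ∅ = ∞`. -/
def orliczNorm {Ω : Type*} [MeasurableSpace Ω] (α : ℝ) (X : Ω → ℝ) (μ : Measure Ω) : ℝ≥0∞ :=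
  sInf (ENNReal.ofReal ''
    {t : ℝ | 0 < t ∧ ∫⁻ ω, ENNReal.ofReal (Real.exp (|X ω| ^ α / t ^ α)) ∂μ ≤ 2})

/-- The `ℓ_r` norm on `ℝᵐ`, for `r ∈ [1, ∞]` (for `r = ∞` it is the maximum norm). -/
def ellNorm {m : ℕ} (r : ℝ≥0∞) (z : Fin m → ℝ) : ℝ := ‖WithLp.toLp r z‖

/-- The closed unit ball `B_r^m = {z ∈ ℝᵐ : ‖z‖_r ≤ 1}`. -/
def ellBall (m : ℕ) (r : ℝ≥0∞) : Set (EuclideanSpace ℝ (Fin m)) :=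
  {z | ellNorm r z.ofLp ≤ 1}

/-- The Euclidean radius `rad(S) = sup_{z ∈ S} ‖z‖₂`. -/
def rad {m : ℕ} (S : Set (EuclideanSpace ℝ (Fin m))) : ℝ≥0∞ := ⨆ z ∈ S, ENNReal.ofReal ‖z‖

/-- `A` is a random matrix with i.i.d. mean-zero, unit-variance, sub-Gaussian entries. -/
structure IsIIDSubGaussianMatrix {Ω : Type*} [MeasurableSpace Ω] {m n : ℕ}
    (A : Ω → Matrix (Fin m) (Fin n) ℝ) (μ : Measure Ω) : Prop where
  measurable_entry : ∀ i j, Measurable fun ω => A ω i j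
  indep : iIndepFun (fun (e : Fin m × Fin n) ω => A ω e.1 e.2) μ
  identDistrib : ∀ i j k l, IdentDistrib (fun ω => A ω i j) (fun ω => A ω k l) μ μ
  mean_zero : ∀ i j, ∫ ω, A ω i j ∂μ = 0
  unit_variance : ∀ i j, variance (fun ω => A ω i j) μ = 1
  subGaussian : ∀ i j, orliczNorm 2 (fun ω => A ω i j) μ < ∞

/-- `‖A₁ x‖_{L^p} = E[|A₁ x|^p]^{1/p}`, where `A₁` is the first row of `A`. -/
def rowNorm {Ω : Type*} [MeasurableSpace Ω] {m n : ℕ} [NeZero m] (p : ℝ)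
    (A : Ω → Matrix (Fin m) (Fin n) ℝ) (μ : Measure Ω) (x : EuclideanSpace ℝ (Fin n)) : ℝ :=
  (∫ ω, |(A ω *ᵥ x.ofLp) 0| ^ p ∂μ) ^ (1 / p)

/-- The process `R_x = ‖A x‖_p - m^{1/p} ‖A₁ x‖_{L^p}`. -/
def processR {Ω : Type*} [MeasurableSpace Ω] {m n : ℕ} [NeZero m] (p : ℝ)
    (A : Ω → Matrix (Fin m) (Fin n) ℝ) (μ : Measure Ω) (x : EuclideanSpace ℝ (Fin n)) (ω : Ω) :
    ℝ :=
  ellNorm (ENNReal.ofReal p) (A ω *ᵥ x.ofLp) - (m : ℝ) ^ (1 / p) * rowNorm p A μ x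

/-- The process `X_x = ‖A x‖_p - E[‖A x‖_p]`. -/
def processX {Ω : Type*} [MeasurableSpace Ω] {m n : ℕ} (p : ℝ)
    (A : Ω → Matrix (Fin m) (Fin n) ℝ) (μ : Measure Ω) (x : EuclideanSpace ℝ (Fin n)) (ω : Ω) :
    ℝ :=
  ellNorm (ENNReal.ofReal p) (A ω *ᵥ x.ofLp) -
    ∫ ω', ellNorm (ENNReal.ofReal p) (A ω' *ᵥ x.ofLp) ∂μ

end

/-! Write `P = max p 2` and `ρ = m ^ (1/p - 1/P)`, which is at most `rad (B_q^m)`. Everything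
reduces to sub-Gaussian tails at scale `ρ` for `R_x`, and at scale `ρ‖x - y‖` for `R_x - R_y`, when
`x` and `y` are unit vectors. Positive homogeneity of `R` then gives all `x, y`, and `X_x - X_y` is
`R_x - R_y` minus its mean.

After division by a multiple of `K`, the coordinates of `Ax`, `Ay` and of `A` applied to the
direction of `x - y` are dominated by independent `Y_i ≥ 0` with `E exp(Y_i²) ≤ 2`. The `p`-th
powers have too heavy a tail for a direct Chernoff bound, but truncation at a level `L ≥ max t (m ^
(1/P))` and a Bernstein argument show that sums of variables bounded by `1 + Y_i ^ P` deviate by at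
most a multiple of `t L ^ (P-1)`, off an event of probability `O(exp(-t²/2))`
(`exists_measure_abs_sum_sub_le`).

`exists_measure_lp_increment_le` takes `p`-th roots. If `t ≤ m ^ (1/P)`, the sums are close to their
means, which are bounded below, and the mean value theorem turns deviations of `p`-th powers, and of
their increments, into deviations of norms. If `t ≥ m ^ (1/P)`, no cancellation is needed: the norms
and their centres are all at most of order `ρ t`.

The powers of `K` come from the rescaling and from the lower bound on `‖A₁x‖_{L^p}`. For `p ≥ 2` the
latter is Jensen; for `p < 2` it follows from the second and fourth moments
(`rpow_le_integral_abs_rpow`). -/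

/-! ### Elementary exponential bounds. -/

theorem Real.exp_le_one_add_add_sq_mul_exp_abs (z : ℝ) :
    Real.exp z ≤ 1 + z + z ^ 2 * Real.exp |z| := by
  have h := Complex.norm_exp_sub_sum_le_norm_mul_exp (z : ℂ) 2
  simp only [Finset.sum_range_succ, Finset.sum_range_zero, pow_zero, Nat.factorial_zero,
    Nat.cast_one, div_one, zero_add, pow_one, Nat.factorial_one, Complex.norm_real,
    Real.norm_eq_abs, sq_abs] at h
  rw [← Complex.ofReal_exp, ← Complex.ofReal_one, ← Complex.ofReal_add, ← Complex.ofReal_sub,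
    Complex.norm_real, Real.norm_eq_abs] at h
  linarith [le_abs_self (Real.exp z - (1 + z))]

theorem exists_rpow_le_mul_exp_sq (P a : ℝ) (hP : 0 ≤ P) (ha : 0 < a) :
    ∃ C : ℝ, 1 ≤ C ∧ ∀ y : ℝ, 0 ≤ y → y ^ P ≤ C * Real.exp (a * y ^ 2) := by
  obtain ⟨k, hk⟩ := exists_nat_ge P
  refine ⟨1 + k.factorial / a ^ k, by linarith [show 0 ≤ (k.factorial : ℝ) / a ^ k by positivity],
    fun y hy => ?_⟩
  have h1 : 1 ≤ Real.exp (a * y ^ 2) := Real.one_le_exp (by positivity)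
  rcases le_total y 1 with hy1 | hy1
  · calc y ^ P ≤ 1 := Real.rpow_le_one hy hy1 hP
      _ ≤ 1 * Real.exp (a * y ^ 2) := by linarith
      _ ≤ _ := by gcongr; linarith [show 0 ≤ (k.factorial : ℝ) / a ^ k by positivity]
  · have h2 := Real.pow_div_factorial_le_exp (a * y ^ 2) (by positivity) k
    calc y ^ P ≤ y ^ (k : ℝ) := Real.rpow_le_rpow_of_exponent_le hy1 hk
      _ = y ^ k := Real.rpow_natCast y k
      _ ≤ (y ^ 2) ^ k := by gcongr; nlinarith
      _ = k.factorial / a ^ k * ((a * y ^ 2) ^ k / k.factorial) := by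
        rw [mul_pow]; field_simp
      _ ≤ k.factorial / a ^ k * Real.exp (a * y ^ 2) := by gcongr
      _ ≤ _ := by gcongr; linarith

/-! ### Tails, the `ψ₂` norm and centring. -/

/-- Layer cake: `E[exp(aZ²) - 1]` is at most `∫ C a exp(-(c - a)t) dt = C a / (c - a)`, and this is
at most `1` exactly when `a (C + 1) ≤ c`. -/
theorem lintegral_exp_sq_le_two_of_tail {Ω : Type*} [MeasurableSpace Ω] {μ : Measure Ω}
    [IsProbabilityMeasure μ] {Z : Ω → ℝ} (hZ : Measurable Z) {C c a : ℝ} (hC : 0 ≤ C)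
    (ha : 0 < a) (hac : a * (C + 1) ≤ c)
    (htail : ∀ t : ℝ, 0 ≤ t → μ.real {ω | t < |Z ω|} ≤ C * Real.exp (-c * t ^ 2)) :
    ∫⁻ ω, ENNReal.ofReal (Real.exp (a * Z ω ^ 2)) ∂μ ≤ 2 := by
  have hint : ∀ x : ℝ, ∫ s in (0 : ℝ)..x, a * Real.exp (a * s) = Real.exp (a * x) - 1 := by
    intro x
    rw [intervalIntegral.integral_eq_sub_of_hasDerivAt (f := fun s => Real.exp (a * s))]
    · simp
    · intro s _
      have := ((hasDerivAt_id s).const_mul a).exp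
      simpa [mul_comm] using this
    · exact Continuous.intervalIntegrable (by fun_prop) _ _
  have hlc := lintegral_comp_eq_lintegral_meas_lt_mul μ (f := fun ω => Z ω ^ 2)
    (g := fun s => a * Real.exp (a * s)) (Filter.Eventually.of_forall fun ω => sq_nonneg (Z ω))
    (by fun_prop) (fun t _ => Continuous.intervalIntegrable (by fun_prop) _ _)
    (Filter.Eventually.of_forall fun s => by positivity)
  simp only [hint] at hlc
  have hbound : ∫⁻ t in Set.Ioi (0 : ℝ),
      μ {ω | t < Z ω ^ 2} * ENNReal.ofReal (a * Real.exp (a * t)) ≤ 1 := by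
    -- For `C = 0` the hypothesis gives only `a ≤ c`, so the exponential below need not decay; but
    -- then the tail itself vanishes.
    rcases hC.eq_or_lt with hC0 | hC0
    · have h1 : ∀ t ∈ Set.Ioi (0 : ℝ),
          μ {ω | t < Z ω ^ 2} * ENNReal.ofReal (a * Real.exp (a * t)) = 0 := by
        intro t ht
        have h2 := htail (√t) (Real.sqrt_nonneg t)
        rw [← hC0, zero_mul] at h2
        have h3 := le_antisymm h2 measureReal_nonneg
        rw [measureReal_eq_zero_iff] at h3
        have h4 : {ω | t < Z ω ^ 2} = {ω | √t < |Z ω|} := by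
          ext ω
          simp only [Set.mem_ofPred_eq]
          rw [← Real.sqrt_sq_eq_abs, Real.sqrt_lt_sqrt_iff (le_of_lt ht)]
        rw [h4, h3, zero_mul]
      rw [setLIntegral_congr_fun measurableSet_Ioi h1]
      simp
    have hca : 0 < c - a := by nlinarith
    have h1 : ∀ t ∈ Set.Ioi (0 : ℝ), μ {ω | t < Z ω ^ 2} * ENNReal.ofReal (a * Real.exp (a * t)) ≤
        ENNReal.ofReal (C * a * Real.exp (-(c - a) * t)) := by
      intro t ht
      have ht0 : (0 : ℝ) ≤ t := le_of_lt ht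
      have h4 : {ω | t < Z ω ^ 2} = {ω | √t < |Z ω|} := by
        ext ω
        simp only [Set.mem_ofPred_eq]
        rw [← Real.sqrt_sq_eq_abs, Real.sqrt_lt_sqrt_iff ht0]
      have h2 := htail (√t) (Real.sqrt_nonneg t)
      rw [Real.sq_sqrt ht0] at h2
      rw [h4, ← ofReal_measureReal, ← ENNReal.ofReal_mul measureReal_nonneg]
      apply ENNReal.ofReal_le_ofReal
      calc _ ≤ C * Real.exp (-c * t) * (a * Real.exp (a * t)) := by gcongr
        _ = C * a * (Real.exp (-c * t) * Real.exp (a * t)) := by ring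
        _ = _ := by rw [← Real.exp_add]; ring_nf
    calc _ ≤ ∫⁻ t in Set.Ioi (0 : ℝ), ENNReal.ofReal (C * a * Real.exp (-(c - a) * t)) :=
          setLIntegral_mono (by fun_prop) h1
      _ = ENNReal.ofReal (∫ t in Set.Ioi (0 : ℝ), C * a * Real.exp (-(c - a) * t)) := by
          rw [ofReal_integral_eq_lintegral_ofReal]
          · exact (exp_neg_integrableOn_Ioi 0 hca).const_mul _
          · exact Filter.Eventually.of_forall fun t => by positivity
      _ ≤ 1 := by
          rw [ENNReal.ofReal_le_one, integral_const_mul,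
            integral_exp_mul_Ioi (by linarith) 0]
          rw [mul_zero, Real.exp_zero, neg_div_neg_eq, mul_one_div, div_le_one hca]
          linarith
  calc ∫⁻ ω, ENNReal.ofReal (Real.exp (a * Z ω ^ 2)) ∂μ
      = ∫⁻ ω, (ENNReal.ofReal (Real.exp (a * Z ω ^ 2) - 1) + 1) ∂μ := by
        refine lintegral_congr fun ω => ?_
        rw [← ENNReal.ofReal_one, ← ENNReal.ofReal_add]
        · simp
        · linarith [Real.one_le_exp (show 0 ≤ a * Z ω ^ 2 by positivity)]
        · exact zero_le_one
    _ = (∫⁻ ω, ENNReal.ofReal (Real.exp (a * Z ω ^ 2) - 1) ∂μ) + 1 := by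
        rw [lintegral_add_right _ measurable_const]; simp
    _ ≤ 1 + 1 := by rw [hlc]; gcongr
    _ = 2 := one_add_one_eq_two

theorem orliczNorm_two_le {Ω : Type*} [MeasurableSpace Ω] {μ : Measure Ω} {X : Ω → ℝ} {t : ℝ}
    (ht : 0 < t) (h : ∫⁻ ω, ENNReal.ofReal (Real.exp (X ω ^ 2 / t ^ 2)) ∂μ ≤ 2) :
    orliczNorm 2 X μ ≤ ENNReal.ofReal t := by
  refine sInf_le ⟨t, ⟨ht, ?_⟩, rfl⟩
  simpa only [Real.rpow_two, sq_abs] using h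

theorem lintegral_exp_sq_le_two_of_orliczNorm_lt {Ω : Type*} [MeasurableSpace Ω] {μ : Measure Ω}
    {X : Ω → ℝ} {t : ℝ} (h : orliczNorm 2 X μ < ENNReal.ofReal t) :
    ∫⁻ ω, ENNReal.ofReal (Real.exp (X ω ^ 2 / t ^ 2)) ∂μ ≤ 2 := by
  obtain ⟨_, ⟨s, ⟨hs, hs2⟩, rfl⟩, hst⟩ := sInf_lt_iff.1 h
  have hst' : s ≤ t := (ENNReal.ofReal_lt_ofReal_iff'.1 hst).1.le
  simp only [Real.rpow_two, sq_abs] at hs2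
  refine le_trans (lintegral_mono fun ω => ?_) hs2
  gcongr

theorem orliczNorm_two_le_of_tail {Ω : Type*} [MeasurableSpace Ω] {μ : Measure Ω}
    [IsProbabilityMeasure μ] {Z : Ω → ℝ} (hZ : Measurable Z) {C τ : ℝ} (hC : 0 ≤ C)
    (hτ : 0 < τ)
    (htail : ∀ t : ℝ, 0 ≤ t → μ.real {ω | τ * t < |Z ω|} ≤ C * Real.exp (-(t ^ 2 / 2))) :
    orliczNorm 2 Z μ ≤ ENNReal.ofReal (√(2 * (C + 1)) * τ) := by
  refine orliczNorm_two_le (by positivity) ?_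
  have h := lintegral_exp_sq_le_two_of_tail (μ := μ) (Z := Z) (C := C) (c := 1 / (2 * τ ^ 2))
    (a := 1 / (√(2 * (C + 1)) * τ) ^ 2) hZ hC (by positivity) ?_ ?_
  · simpa only [one_div_mul_eq_div] using h
  · rw [mul_pow, Real.sq_sqrt (by positivity)]
    apply le_of_eq
    field_simp
  · intro t ht
    have := htail (t / τ) (by positivity)
    rw [mul_div_cancel₀ _ hτ.ne'] at this
    refine this.trans_eq ?_
    congr 2
    field_simp

theorem orliczNorm_two_zero {Ω : Type*} [MeasurableSpace Ω] (μ : Measure Ω)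
    [IsProbabilityMeasure μ] : orliczNorm 2 (fun _ : Ω => (0 : ℝ)) μ = 0 := by
  refine le_antisymm (ENNReal.le_of_forall_pos_le_add fun ε hε _ => ?_) zero_le
  have := orliczNorm_two_le (μ := μ) (X := fun _ : Ω => (0 : ℝ)) (t := ε) hε (by simp)
  simpa using this

/-- Since `|z| ≤ (t/2) exp(z²/t²)`, the mean `e` satisfies `|e| ≤ t`. Then `(z - e)² ≤ 2z² + 2e²`
and `exp(w/2) ≤ (exp w + 1)/2` bound the integrand by `(2/3) exp(z²/t²) + 2/3`, whose integral is at
most `2`. The factor `3` leaves room for `exp(2/9) ≤ 4/3`. -/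
theorem lintegral_exp_sq_sub_integral_le_two {Ω : Type*} [MeasurableSpace Ω] {μ : Measure Ω}
    [IsProbabilityMeasure μ] {Z : Ω → ℝ} {t : ℝ} (ht : 0 < t)
    (h : ∫⁻ ω, ENNReal.ofReal (Real.exp (Z ω ^ 2 / t ^ 2)) ∂μ ≤ 2) :
    ∫⁻ ω, ENNReal.ofReal (Real.exp ((Z ω - ∫ ω', Z ω' ∂μ) ^ 2 / (3 * t) ^ 2)) ∂μ ≤ 2 := by
  set e := ∫ ω', Z ω' ∂μ with he
  have hpt : ∀ z : ℝ, |z| ≤ t / 2 * Real.exp (z ^ 2 / t ^ 2) := by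
    intro z
    have h1 := Real.add_one_le_exp (z ^ 2 / t ^ 2)
    have h2 : |z| / t ≤ (z ^ 2 / t ^ 2 + 1) / 2 := by
      have : z ^ 2 / t ^ 2 = (|z| / t) ^ 2 := by rw [div_pow, sq_abs]
      rw [this]
      nlinarith [sq_nonneg (|z| / t - 1)]
    rw [div_le_iff₀ ht] at h2
    nlinarith
  have he1 : |e| ≤ t := by
    have h1 : ∫⁻ ω, ENNReal.ofReal ‖Z ω‖ ∂μ ≤ ENNReal.ofReal t := by
      calc _ ≤ ∫⁻ ω, ENNReal.ofReal (t / 2) * ENNReal.ofReal (Real.exp (Z ω ^ 2 / t ^ 2)) ∂μ := by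
            refine lintegral_mono fun ω => ?_
            rw [← ENNReal.ofReal_mul (by positivity)]
            exact ENNReal.ofReal_le_ofReal (hpt (Z ω))
        _ = ENNReal.ofReal (t / 2) * ∫⁻ ω, ENNReal.ofReal (Real.exp (Z ω ^ 2 / t ^ 2)) ∂μ :=
            lintegral_const_mul' _ _ ENNReal.ofReal_ne_top
        _ ≤ ENNReal.ofReal (t / 2) * ENNReal.ofReal 2 := by
            gcongr
            simpa using h
        _ = ENNReal.ofReal t := by
            rw [← ENNReal.ofReal_mul (by positivity)]
            congr 1; ring
    have h2 := norm_integral_le_lintegral_norm (μ := μ) Z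
    exact h2.trans (ENNReal.toReal_le_of_le_ofReal ht.le h1)
  have he2 : e ^ 2 / t ^ 2 ≤ 1 := by
    rw [← div_pow, ← sq_abs, abs_div, abs_of_pos ht]
    exact pow_le_one₀ (by positivity) ((div_le_one ht).2 he1)
  have hexp : Real.exp (2 / 9) ≤ 4 / 3 := by
    have := Real.exp_bound_div_one_sub_of_interval (x := 2 / 9) (by norm_num) (by norm_num)
    linarith
  have hpt2 : ∀ z : ℝ, Real.exp ((z - e) ^ 2 / (3 * t) ^ 2) ≤
      2 / 3 * Real.exp (z ^ 2 / t ^ 2) + 2 / 3 := by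
    intro z
    have hw : 0 ≤ z ^ 2 / t ^ 2 := by positivity
    have h1 : (z - e) ^ 2 / (3 * t) ^ 2 ≤ 2 / 9 + z ^ 2 / t ^ 2 / 2 := by
      have : (z - e) ^ 2 / (3 * t) ^ 2 ≤ 2 / 9 * (z ^ 2 / t ^ 2) + 2 / 9 * (e ^ 2 / t ^ 2) := by
        have h3 : (z - e) ^ 2 ≤ 2 * z ^ 2 + 2 * e ^ 2 := by nlinarith [sq_nonneg (z + e)]
        calc _ ≤ (2 * z ^ 2 + 2 * e ^ 2) / (3 * t) ^ 2 := by gcongr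
          _ = _ := by field_simp; ring
      linarith
    have h2 : Real.exp (z ^ 2 / t ^ 2 / 2) ≤ (Real.exp (z ^ 2 / t ^ 2) + 1) / 2 := by
      have : Real.exp (z ^ 2 / t ^ 2) = Real.exp (z ^ 2 / t ^ 2 / 2) ^ 2 := by
        rw [← Real.exp_nat_mul]; congr 1; push_cast; ring
      nlinarith [sq_nonneg (Real.exp (z ^ 2 / t ^ 2 / 2) - 1)]
    calc _ ≤ Real.exp (2 / 9 + z ^ 2 / t ^ 2 / 2) := Real.exp_le_exp.2 h1
      _ = Real.exp (2 / 9) * Real.exp (z ^ 2 / t ^ 2 / 2) := Real.exp_add _ _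
      _ ≤ 4 / 3 * ((Real.exp (z ^ 2 / t ^ 2) + 1) / 2) := by gcongr
      _ = _ := by ring
  calc _ ≤ ∫⁻ ω, (ENNReal.ofReal (2 / 3) * ENNReal.ofReal (Real.exp (Z ω ^ 2 / t ^ 2)) +
        ENNReal.ofReal (2 / 3)) ∂μ := by
        refine lintegral_mono fun ω => ?_
        rw [← ENNReal.ofReal_mul (by norm_num), ← ENNReal.ofReal_add (by positivity) (by norm_num)]
        exact ENNReal.ofReal_le_ofReal (hpt2 (Z ω))
    _ = ENNReal.ofReal (2 / 3) * ∫⁻ ω, ENNReal.ofReal (Real.exp (Z ω ^ 2 / t ^ 2)) ∂μ +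
        ENNReal.ofReal (2 / 3) := by
        rw [lintegral_add_right _ measurable_const, lintegral_const_mul' _ _ ENNReal.ofReal_ne_top]
        simp
    _ ≤ ENNReal.ofReal (2 / 3) * ENNReal.ofReal 2 + ENNReal.ofReal (2 / 3) := by
        gcongr
        simpa using h
    _ = ENNReal.ofReal 2 := by
        rw [← ENNReal.ofReal_mul (by norm_num), ← ENNReal.ofReal_add (by norm_num) (by norm_num)]
        norm_num
    _ = 2 := by simp

theorem orliczNorm_two_sub_integral_le {Ω : Type*} [MeasurableSpace Ω] {μ : Measure Ω}
    [IsProbabilityMeasure μ] {Z : Ω → ℝ} :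
    orliczNorm 2 (fun ω => Z ω - ∫ ω', Z ω' ∂μ) μ ≤ 3 * orliczNorm 2 Z μ := by
  rw [mul_comm, ← ENNReal.div_le_iff (by norm_num) (by norm_num)]
  refine le_sInf ?_
  rintro _ ⟨t, ⟨ht, h⟩, rfl⟩
  simp only [Real.rpow_two, sq_abs] at h
  rw [ENNReal.div_le_iff (by norm_num) (by norm_num)]
  refine (orliczNorm_two_le (t := 3 * t) (by positivity)
    (lintegral_exp_sq_sub_integral_le_two ht h)).trans_eq ?_
  rw [mul_comm, ENNReal.ofReal_mul ht.le]
  simp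

/-! ### Bernstein inequality for heavy-tailed sums by truncation. -/

section Truncation

variable {Ω : Type*} [MeasurableSpace Ω] {μ : Measure Ω}

theorem integrable_of_abs_le_mul_exp_sq {Y ξ : Ω → ℝ} {C : ℝ} (hξ : Measurable ξ)
    (hint : Integrable (fun ω => Real.exp (Y ω ^ 2)) μ)
    (h : ∀ ω, |ξ ω| ≤ C * Real.exp (Y ω ^ 2)) : Integrable ξ μ :=
  (hint.const_mul C).mono' hξ.aestronglyMeasurable (Filter.Eventually.of_forall h)

theorem integral_le_of_le_mul_exp_sq {Y ξ : Ω → ℝ} {C : ℝ} (hξ : Measurable ξ) (hC : 0 ≤ C)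
    (hint : Integrable (fun ω => Real.exp (Y ω ^ 2)) μ)
    (hY : ∫ ω, Real.exp (Y ω ^ 2) ∂μ ≤ 2)
    (h : ∀ ω, |ξ ω| ≤ C * Real.exp (Y ω ^ 2)) : ∫ ω, |ξ ω| ∂μ ≤ 2 * C := by
  calc _ ≤ ∫ ω, C * Real.exp (Y ω ^ 2) ∂μ :=
        integral_mono (integrable_of_abs_le_mul_exp_sq hξ hint h).abs (hint.const_mul C) h
    _ = C * ∫ ω, Real.exp (Y ω ^ 2) ∂μ := integral_const_mul _ _
    _ ≤ 2 * C := by nlinarith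

/-- Bernstein-type bound for the moment generating function of a truncated random variable with
a heavy tail. -/
theorem exists_mgf_truncation_le (P : ℝ) (hP : 2 ≤ P) :
    ∃ C : ℝ, 1 ≤ C ∧ ∀ {Ω : Type*} [MeasurableSpace Ω] (μ : Measure Ω) [IsProbabilityMeasure μ]
      (Y ξ : Ω → ℝ), Measurable Y → Measurable ξ → (∀ ω, 0 ≤ Y ω) →
      (∀ ω, |ξ ω| ≤ 1 + Y ω ^ P) → Integrable (fun ω => Real.exp (Y ω ^ 2)) μ →
      ∫ ω, Real.exp (Y ω ^ 2) ∂μ ≤ 2 → ∀ L l : ℝ, 0 < L → 0 ≤ l → l ≤ 1 →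
      l * L ^ (P - 2) ≤ 1 / 2 →
      Integrable (fun ω => Real.exp (l * {ω | Y ω ≤ L}.indicator ξ ω)) μ ∧
      mgf ({ω | Y ω ≤ L}.indicator ξ) μ l ≤
        Real.exp (l * ∫ ω, {ω | Y ω ≤ L}.indicator ξ ω ∂μ + C * l ^ 2) := by
  obtain ⟨C₁, hC₁, hC₁'⟩ := exists_rpow_le_mul_exp_sq P (1 / 4) (by linarith) (by norm_num)
  have he1 : 1 ≤ Real.exp 1 := Real.one_le_exp zero_le_one
  refine ⟨2 * (4 * C₁ ^ 2 * Real.exp 1), by nlinarith, ?_⟩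
  intro Ω _ μ _ Y ξ hYm hξm hY0 hξ hint hEY L l hL hl0 hl1 hlL
  set ζ : Ω → ℝ := {ω | Y ω ≤ L}.indicator ξ with hζ
  have hset : MeasurableSet {ω | Y ω ≤ L} := measurableSet_le hYm measurable_const
  have hζm : Measurable ζ := hξm.indicator hset
  have hξC : ∀ ω, |ξ ω| ≤ 2 * C₁ * Real.exp (1 / 4 * Y ω ^ 2) := by
    intro ω
    have h1 := hC₁' (Y ω) (hY0 ω)
    have h2 : 1 ≤ Real.exp (1 / 4 * Y ω ^ 2) := Real.one_le_exp (by positivity)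
    nlinarith [hξ ω]
  have hζξ : ∀ ω, |ζ ω| ≤ |ξ ω| := by
    intro ω
    by_cases h : Y ω ≤ L
    · simp [hζ, h]
    · simp [hζ, h]
  -- Below the level `L` one has `Y ^ P ≤ L ^ (P - 2) * Y ^ 2`, so the condition on `l` makes the
  -- exponent cost only half of the available `Y ^ 2`. The other half pays for `ζ ^ 2` in the Taylor
  -- remainder.
  have hlζ : ∀ ω, l * |ζ ω| ≤ 1 + Y ω ^ 2 / 2 := by
    intro ω
    by_cases h : Y ω ≤ L
    · have h1 : ζ ω = ξ ω := by simp [hζ, h]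
      rw [h1]
      have h2 : Y ω ^ P ≤ Y ω ^ 2 * L ^ (P - 2) := by
        rcases (hY0 ω).eq_or_lt with h0 | h0
        · rw [← h0, Real.zero_rpow (by linarith)]; simp
        · calc Y ω ^ P = Y ω ^ (2 + (P - 2)) := by ring_nf
            _ = Y ω ^ 2 * Y ω ^ (P - 2) := by rw [Real.rpow_add h0, Real.rpow_two]
            _ ≤ _ := by gcongr
      calc l * |ξ ω| ≤ l * (1 + Y ω ^ 2 * L ^ (P - 2)) := by
            gcongr; linarith [hξ ω]
        _ = l + Y ω ^ 2 * (l * L ^ (P - 2)) := by ring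
        _ ≤ 1 + Y ω ^ 2 * (1 / 2) := by gcongr
        _ = _ := by ring
    · have h1 : ζ ω = 0 := by simp [hζ, h]
      rw [h1, abs_zero, mul_zero]; positivity
  have hexpsq : ∀ ω, Real.exp (1 + Y ω ^ 2 / 2) ≤ Real.exp 1 * Real.exp (Y ω ^ 2) := by
    intro ω
    rw [← Real.exp_add]
    apply Real.exp_le_exp.2
    nlinarith [sq_nonneg (Y ω)]
  have hpt : ∀ ω, Real.exp (l * ζ ω) ≤
      1 + l * ζ ω + l ^ 2 * (4 * C₁ ^ 2 * Real.exp 1) * Real.exp (Y ω ^ 2) := by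
    intro ω
    have h1 := Real.exp_le_one_add_add_sq_mul_exp_abs (l * ζ ω)
    have h2 : |l * ζ ω| ≤ 1 + Y ω ^ 2 / 2 := by
      rw [abs_mul, abs_of_nonneg hl0]; exact hlζ ω
    have h3 : ζ ω ^ 2 ≤ 4 * C₁ ^ 2 * Real.exp (Y ω ^ 2 / 2) := by
      have h4 : Real.exp (Y ω ^ 2 / 2) = Real.exp (1 / 4 * Y ω ^ 2) ^ 2 := by
        rw [← Real.exp_nat_mul]; congr 1; push_cast; ring
      rw [h4, ← sq_abs]
      calc |ζ ω| ^ 2 ≤ (2 * C₁ * Real.exp (1 / 4 * Y ω ^ 2)) ^ 2 := by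
            gcongr; exact (hζξ ω).trans (hξC ω)
        _ = _ := by ring
    calc _ ≤ _ := h1
      _ ≤ 1 + l * ζ ω + l ^ 2 * (4 * C₁ ^ 2 * Real.exp (Y ω ^ 2 / 2)) *
          Real.exp (1 + Y ω ^ 2 / 2) := by
          rw [mul_pow]; gcongr
      _ = 1 + l * ζ ω + l ^ 2 * (4 * C₁ ^ 2 * Real.exp 1) * Real.exp (Y ω ^ 2) := by
          rw [Real.exp_add]
          have : Real.exp (Y ω ^ 2) = Real.exp (Y ω ^ 2 / 2) * Real.exp (Y ω ^ 2 / 2) := by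
            rw [← Real.exp_add]; ring_nf
          rw [this]; ring
  have hintexp : Integrable (fun ω => Real.exp (l * ζ ω)) μ := by
    refine integrable_of_abs_le_mul_exp_sq (C := Real.exp 1) (by fun_prop) hint fun ω => ?_
    rw [Real.abs_exp]
    refine le_trans (Real.exp_le_exp.2 ?_) (hexpsq ω)
    exact (mul_le_mul_of_nonneg_left (le_abs_self _) hl0).trans (hlζ ω)
  have hintζ : Integrable ζ μ := by
    refine integrable_of_abs_le_mul_exp_sq (C := 2 * C₁) hζm hint fun ω => ?_
    refine (hζξ ω).trans ((hξC ω).trans ?_)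
    gcongr
    nlinarith [sq_nonneg (Y ω)]
  refine ⟨hintexp, ?_⟩
  calc mgf ζ μ l = ∫ ω, Real.exp (l * ζ ω) ∂μ := rfl
    _ ≤ ∫ ω, (1 + l * ζ ω + l ^ 2 * (4 * C₁ ^ 2 * Real.exp 1) * Real.exp (Y ω ^ 2)) ∂μ :=
        integral_mono hintexp
          (((integrable_const _).add (hintζ.const_mul l)).add (hint.const_mul _)) hpt
    _ = 1 + l * ∫ ω, ζ ω ∂μ +
        l ^ 2 * (4 * C₁ ^ 2 * Real.exp 1) * ∫ ω, Real.exp (Y ω ^ 2) ∂μ := by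
        have i1 : Integrable (fun ω => 1 + l * ζ ω) μ :=
          (integrable_const _).add (hintζ.const_mul l)
        rw [integral_add i1 (hint.const_mul _), integral_add (integrable_const _)
          (hintζ.const_mul l), integral_const_mul, integral_const_mul]
        simp
    _ ≤ 1 + l * ∫ ω, ζ ω ∂μ + l ^ 2 * (4 * C₁ ^ 2 * Real.exp 1) * 2 := by gcongr
    _ = (l * ∫ ω, ζ ω ∂μ + 2 * (4 * C₁ ^ 2 * Real.exp 1) * l ^ 2) + 1 := by ring
    _ ≤ _ := Real.add_one_le_exp _

end Truncation

/-- The upper tail of a sum of independent truncated random variables. -/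
theorem exists_measure_sum_truncation_le (P : ℝ) (hP : 2 ≤ P) :
    ∃ C : ℝ, 1 ≤ C ∧ ∀ {Ω : Type*} [MeasurableSpace Ω] (μ : Measure Ω) [IsProbabilityMeasure μ]
      {ι : Type} [Fintype ι] (Y ξ : ι → Ω → ℝ), (∀ i, Measurable (Y i)) → (∀ i, Measurable (ξ i)) →
      (∀ i ω, 0 ≤ Y i ω) → (∀ i ω, |ξ i ω| ≤ 1 + Y i ω ^ P) →
      (∀ i, Integrable (fun ω => Real.exp (Y i ω ^ 2)) μ) →
      (∀ i, ∫ ω, Real.exp (Y i ω ^ 2) ∂μ ≤ 2) →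
      iIndepFun (fun i ω => (ξ i ω, Y i ω)) μ → ∀ t L : ℝ, 1 ≤ t → t ≤ L →
      (Fintype.card ι : ℝ) ≤ L ^ P →
      μ.real {ω | ∑ i, ∫ ω', {ω' | Y i ω' ≤ L}.indicator (ξ i) ω' ∂μ + C * (t * L ^ (P - 1)) ≤
        ∑ i, {ω' | Y i ω' ≤ L}.indicator (ξ i) ω} ≤ Real.exp (-(t ^ 2 / 2)) := by
  obtain ⟨C₀, hC₀, hmgf⟩ := exists_mgf_truncation_le P hP
  refine ⟨1 + C₀, by linarith, ?_⟩
  intro Ω _ μ _ ι _ Y ξ hYm hξm hY0 hξ hint hEY hind t L ht htL hcard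
  have hL : 1 ≤ L := ht.trans htL
  have hL0 : 0 < L := by linarith
  -- Chernoff parameter: `l * (t * L ^ (P - 1)) = t ^ 2 / 2`, while `l * L ^ (P - 2) = t / (2 * L) ≤
  -- 1 / 2` and `card ι * l ^ 2 ≤ L ^ P * l ^ 2 ≤ t ^ 2 / 4`. The threshold `1 + C₀` therefore
  -- absorbs the quadratic terms and leaves `-t ^ 2 / 2`.
  set l : ℝ := t * L ^ (1 - P) / 2 with hl
  have hl0 : 0 ≤ l := by positivity
  have hLP : L ^ (1 - P) * L ^ (P - 1) = 1 := by
    rw [← Real.rpow_add hL0]; simp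
  have hl2 : l * L ^ (P - 2) ≤ 1 / 2 := by
    have : L ^ (1 - P) * L ^ (P - 2) = L⁻¹ := by
      rw [← Real.rpow_add hL0, ← Real.rpow_neg_one]; ring_nf
    calc l * L ^ (P - 2) = t / 2 * (L ^ (1 - P) * L ^ (P - 2)) := by rw [hl]; ring
      _ = t / L / 2 := by rw [this]; ring
      _ ≤ 1 / 2 := by gcongr; exact (div_le_one hL0).2 htL
  have hl1 : l ≤ 1 := by
    have : 1 ≤ L ^ (P - 2) := Real.one_le_rpow hL (by linarith)
    nlinarith
  set ζ : ι → Ω → ℝ := fun i => {ω | Y i ω ≤ L}.indicator (ξ i) with hζ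
  have hζm : ∀ i, Measurable (ζ i) := fun i =>
    (hξm i).indicator (measurableSet_le (hYm i) measurable_const)
  have hζind : iIndepFun ζ μ := by
    have := hind.comp (fun _ z => if z.2 ≤ L then z.1 else 0) (fun _ =>
      Measurable.ite (measurableSet_le measurable_snd measurable_const) measurable_fst
        measurable_const)
    convert this using 2 with i
    ext ω
    simp [hζ, Set.indicator]
  have hm := fun i => hmgf μ (Y i) (ξ i) (hYm i) (hξm i) (hY0 i) (hξ i) (hint i) (hEY i) L l hL0
    hl0 hl1 hl2
  have hsum := hζind.mgf_sum (t := l) hζm Finset.univ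
  set E := ∑ i, ∫ ω', ζ i ω' ∂μ with hE
  have hch := measure_ge_le_exp_mul_mgf (μ := μ) (X := ∑ i, ζ i) (t := l)
    (E + (1 + C₀) * (t * L ^ (P - 1))) hl0
    (hζind.integrable_exp_mul_sum hζm fun i _ => (hm i).1)
  simp only [Finset.sum_apply] at hch
  refine hch.trans ?_
  rw [hsum]
  calc _ ≤ Real.exp (-l * (E + (1 + C₀) * (t * L ^ (P - 1)))) *
        ∏ i, Real.exp (l * ∫ ω, ζ i ω ∂μ + C₀ * l ^ 2) := by
        gcongr with i
        · intro i _; exact mgf_nonneg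
        · exact (hm i).2
    _ = Real.exp (-l * (E + (1 + C₀) * (t * L ^ (P - 1))) +
          (l * E + Fintype.card ι * (C₀ * l ^ 2))) := by
        rw [← Real.exp_sum, ← Real.exp_add, Finset.sum_add_distrib, ← Finset.mul_sum]
        simp [hE]
    _ ≤ _ := by
        apply Real.exp_le_exp.2
        have h1 : l * (t * L ^ (P - 1)) = t ^ 2 / 2 := by
          calc _ = t ^ 2 / 2 * (L ^ (1 - P) * L ^ (P - 1)) := by rw [hl]; ring
            _ = _ := by rw [hLP, mul_one]
        have h2 : Fintype.card ι * l ^ 2 ≤ t ^ 2 / 4 := by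
          calc _ ≤ L ^ P * l ^ 2 := by gcongr
            _ = t ^ 2 / 4 * (L ^ P * (L ^ (1 - P)) ^ 2) := by rw [hl]; ring
            _ = t ^ 2 / 4 * L ^ (2 - P) := by
                rw [← Real.rpow_natCast (L ^ (1 - P)) 2, ← Real.rpow_mul hL0.le, ← Real.rpow_add hL0]
                congr 2; push_cast; ring
            _ ≤ t ^ 2 / 4 * 1 := by
                gcongr
                exact Real.rpow_le_one_of_one_le_of_nonpos hL (by linarith)
            _ = _ := mul_one _
        nlinarith [sq_nonneg t]

/-- Concentration of sums of independent random variables dominated by `1 + Y ^ P`, where `Y` is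
sub-Gaussian. -/
theorem exists_measure_abs_sum_sub_le (P : ℝ) (hP : 2 ≤ P) :
    ∃ C : ℝ, 1 ≤ C ∧ ∀ {Ω : Type*} [MeasurableSpace Ω] (μ : Measure Ω) [IsProbabilityMeasure μ]
      {ι : Type} [Fintype ι] (Y ξ : ι → Ω → ℝ), (∀ i, Measurable (Y i)) → (∀ i, Measurable (ξ i)) →
      (∀ i ω, 0 ≤ Y i ω) → (∀ i ω, |ξ i ω| ≤ 1 + Y i ω ^ P) →
      (∀ i, Integrable (fun ω => Real.exp (Y i ω ^ 2)) μ) →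
      (∀ i, ∫ ω, Real.exp (Y i ω ^ 2) ∂μ ≤ 2) →
      iIndepFun (fun i ω => (ξ i ω, Y i ω)) μ → ∀ t L : ℝ, 1 ≤ t → t ≤ L →
      (Fintype.card ι : ℝ) ≤ L ^ P →
      μ.real {ω | C * (t * L ^ (P - 1)) ≤ |∑ i, ξ i ω - ∑ i, ∫ ω', ξ i ω' ∂μ|} ≤
        C * Real.exp (-(t ^ 2 / 2)) := by
  obtain ⟨C₀, hC₀, htr⟩ := exists_measure_sum_truncation_le P hP
  obtain ⟨C₁, hC₁, hC₁'⟩ := exists_rpow_le_mul_exp_sq P (1 / 2) (by linarith) (by norm_num)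
  have hC₁2 : C₁ ≤ C₁ ^ 2 := by nlinarith
  refine ⟨2 + C₀ + 4 * C₁ ^ 2, by nlinarith, ?_⟩
  intro Ω _ μ _ ι _ Y ξ hYm hξm hY0 hξ hint hEY hind t L ht htL hcard
  have hL : 1 ≤ L := ht.trans htL
  have hL0 : 0 < L := by linarith
  set S : ι → Set Ω := fun i => {ω | Y i ω ≤ L} with hS
  have hSm : ∀ i, MeasurableSet (S i) := fun i => measurableSet_le (hYm i) measurable_const
  -- the bias of the truncation
  have hYP : ∀ i ω, 1 + Y i ω ^ P ≤ 2 * C₁ * Real.exp (1 / 2 * Y i ω ^ 2) := by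
    intro i ω
    have h1 := hC₁' (Y i ω) (hY0 i ω)
    have h2 : 1 ≤ Real.exp (1 / 2 * Y i ω ^ 2) := Real.one_le_exp (by positivity)
    nlinarith
  have hξint : ∀ i, Integrable (ξ i) μ := by
    intro i
    refine integrable_of_abs_le_mul_exp_sq (C := 2 * C₁) (hξm i) (hint i) fun ω => ?_
    refine (hξ i ω).trans ((hYP i ω).trans ?_)
    gcongr
    nlinarith [sq_nonneg (Y i ω)]
  -- Where the truncation acts, `1 ≤ Y ^ P / L ^ P`; inserting this factor gives a bias of order `L
  -- ^ (-P)` per variable, hence `O(1)` in total because `card ι ≤ L ^ P`. This is absorbed by `t *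
  -- L ^ (P - 1) ≥ 1`.
  have hbias : ∀ i, |∫ ω, (S i).indicator (ξ i) ω ∂μ - ∫ ω, ξ i ω ∂μ| ≤ 4 * C₁ ^ 2 / L ^ P := by
    intro i
    have h1 : ∫ ω, (S i).indicator (ξ i) ω ∂μ - ∫ ω, ξ i ω ∂μ =
        ∫ ω, ((S i).indicator (ξ i) ω - ξ i ω) ∂μ :=
      (integral_sub ((hξint i).indicator (hSm i)) (hξint i)).symm
    rw [h1]
    refine (abs_integral_le_integral_abs).trans ?_
    have := integral_le_of_le_mul_exp_sq (μ := μ) (Y := Y i)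
      (ξ := fun ω => (S i).indicator (ξ i) ω - ξ i ω) (C := 2 * C₁ ^ 2 / L ^ P)
      (((hξm i).indicator (hSm i)).sub (hξm i)) (by positivity) (hint i) (hEY i) ?_
    · refine this.trans_eq (by ring)
    · intro ω
      by_cases h : Y i ω ≤ L
      · have : ω ∈ S i := h
        simp only [this, Set.indicator_of_mem, sub_self, abs_zero]
        positivity
      · have h2 : ω ∉ S i := h
        simp only [h2, not_false_eq_true, Set.indicator_of_notMem, zero_sub, abs_neg]
        have h3 : 1 ≤ Y i ω ^ P / L ^ P := by
          rw [one_le_div (by positivity)]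
          exact Real.rpow_le_rpow hL0.le (not_le.1 h).le (by linarith)
        calc |ξ i ω| ≤ 1 + Y i ω ^ P := hξ i ω
          _ ≤ (1 + Y i ω ^ P) * (Y i ω ^ P / L ^ P) := by
              have : 0 ≤ Y i ω ^ P := Real.rpow_nonneg (hY0 i ω) _
              nlinarith
          _ ≤ (2 * C₁ * Real.exp (1 / 2 * Y i ω ^ 2)) *
              (C₁ * Real.exp (1 / 2 * Y i ω ^ 2) / L ^ P) := by
              have := Real.rpow_nonneg (hY0 i ω) P
              gcongr
              · exact hYP i ω
              · exact hC₁' _ (hY0 i ω)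
          _ = 2 * C₁ ^ 2 / L ^ P *
              (Real.exp (1 / 2 * Y i ω ^ 2) * Real.exp (1 / 2 * Y i ω ^ 2)) := by ring
          _ = _ := by rw [← Real.exp_add]; ring_nf
  have hbias_sum : |∑ i, ∫ ω, (S i).indicator (ξ i) ω ∂μ - ∑ i, ∫ ω, ξ i ω ∂μ| ≤ 4 * C₁ ^ 2 := by
    rw [← Finset.sum_sub_distrib]
    calc _ ≤ ∑ i : ι, 4 * C₁ ^ 2 / L ^ P :=
          (Finset.abs_sum_le_sum_abs _ _).trans (Finset.sum_le_sum fun i _ => hbias i)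
      _ = Fintype.card ι / L ^ P * (4 * C₁ ^ 2) := by
          rw [Finset.sum_const, nsmul_eq_mul, Finset.card_univ]; ring
      _ ≤ 1 * (4 * C₁ ^ 2) := by
          gcongr; exact (div_le_one (by positivity)).2 hcard
      _ = _ := one_mul _
  -- the probability that the truncation is active
  have hbig : ∀ i, μ.real {ω | L < Y i ω} ≤ 2 * Real.exp (-L ^ 2) := by
    intro i
    have h1 := mul_meas_ge_le_integral_of_nonneg (μ := μ) (f := fun ω => Real.exp (Y i ω ^ 2))
      (Filter.Eventually.of_forall fun ω => (Real.exp_pos _).le) (hint i) (Real.exp (L ^ 2))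
    have h2 : μ.real {ω | L < Y i ω} ≤ μ.real {ω | Real.exp (L ^ 2) ≤ Real.exp (Y i ω ^ 2)} := by
      refine measureReal_mono fun ω (hω : L < Y i ω) => Real.exp_le_exp.2 ?_
      gcongr
    rw [Real.exp_neg, ← div_eq_mul_inv, le_div_iff₀ (Real.exp_pos _), mul_comm]
    calc _ ≤ _ := mul_le_mul_of_nonneg_left h2 (Real.exp_pos _).le
      _ ≤ _ := h1
      _ ≤ 2 := hEY i
  -- The union bound costs `card ι ≤ L ^ P`, of order `exp (L ^ 2 / 2)`, which is half of the decay
  -- `exp (-L ^ 2)`. The remaining half is enough since `t ≤ L`.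
  have hbig_sum : μ.real (⋃ i, {ω | L < Y i ω}) ≤ 2 * C₁ * Real.exp (-(t ^ 2 / 2)) := by
    calc _ ≤ ∑ i, μ.real {ω | L < Y i ω} := measureReal_iUnion_fintype_le _
      _ ≤ ∑ i : ι, 2 * Real.exp (-L ^ 2) := Finset.sum_le_sum fun i _ => hbig i
      _ = Fintype.card ι * (2 * Real.exp (-L ^ 2)) := by
          rw [Finset.sum_const, nsmul_eq_mul, Finset.card_univ]
      _ ≤ C₁ * Real.exp (1 / 2 * L ^ 2) * (2 * Real.exp (-L ^ 2)) := by
          gcongr; exact hcard.trans (hC₁' L hL0.le)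
      _ = 2 * C₁ * (Real.exp (1 / 2 * L ^ 2) * Real.exp (-L ^ 2)) := by ring
      _ ≤ _ := by
          rw [← Real.exp_add]
          gcongr
          nlinarith
  -- the two one-sided tails
  have htail1 := htr μ Y ξ hYm hξm hY0 hξ hint hEY hind t L ht htL hcard
  have htail2 := htr μ Y (fun i ω => -ξ i ω) hYm (fun i => (hξm i).neg) hY0
    (by simpa using hξ) hint hEY
    (hind.comp (fun _ z => (-z.1, z.2)) (fun _ => by fun_prop)) t L ht htL hcard
  set E' := ∑ i, ∫ ω, (S i).indicator (ξ i) ω ∂μ with hE'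
  set E := ∑ i, ∫ ω, ξ i ω ∂μ with hE
  have hneg : ∀ i ω, {ω' | Y i ω' ≤ L}.indicator (fun ω => -ξ i ω) ω =
      -(S i).indicator (ξ i) ω := by
    intro i ω
    exact congrFun (Set.indicator_neg (S i) (ξ i)) ω
  simp only [hneg, integral_neg, Finset.sum_neg_distrib] at htail2
  have hsub : {ω | (2 + C₀ + 4 * C₁ ^ 2) * (t * L ^ (P - 1)) ≤ |∑ i, ξ i ω - E|} ⊆
      (⋃ i, {ω | L < Y i ω}) ∪
      ({ω | E' + C₀ * (t * L ^ (P - 1)) ≤ ∑ i, (S i).indicator (ξ i) ω} ∪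
       {ω | -E' + C₀ * (t * L ^ (P - 1)) ≤ -∑ i, (S i).indicator (ξ i) ω}) := by
    intro ω hω
    by_cases h : ω ∈ ⋃ i, {ω | L < Y i ω}
    · exact Or.inl h
    right
    simp only [Set.mem_iUnion, Set.mem_ofPred_eq, not_exists, not_lt] at h
    have heq : ∑ i, (S i).indicator (ξ i) ω = ∑ i, ξ i ω :=
      Finset.sum_congr rfl fun i _ => Set.indicator_of_mem (show ω ∈ S i from h i) _
    simp only [Set.mem_union, Set.mem_ofPred_eq] at hω ⊢
    rw [heq]
    have h1 : 1 ≤ t * L ^ (P - 1) := by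
      have := Real.one_le_rpow hL (show 0 ≤ P - 1 by linarith)
      nlinarith
    have h2 : (2 + C₀ + 4 * C₁ ^ 2) * (t * L ^ (P - 1)) ≥
        C₀ * (t * L ^ (P - 1)) + 4 * C₁ ^ 2 := by nlinarith [sq_nonneg C₁]
    rw [abs_le] at hbias_sum
    rcases le_abs.1 hω with h3 | h3
    · left; linarith [hbias_sum.1, hbias_sum.2]
    · right; linarith [hbias_sum.1, hbias_sum.2]
  calc _ ≤ _ := measureReal_mono hsub
    _ ≤ _ := measureReal_union_le _ _
    _ ≤ 2 * C₁ * Real.exp (-(t ^ 2 / 2)) +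
        (Real.exp (-(t ^ 2 / 2)) + Real.exp (-(t ^ 2 / 2))) :=
        add_le_add hbig_sum ((measureReal_union_le _ _).trans (add_le_add htail1 htail2))
    _ = (2 * C₁ + 2) * Real.exp (-(t ^ 2 / 2)) := by ring
    _ ≤ _ := mul_le_mul_of_nonneg_right (by nlinarith) (Real.exp_pos _).le

/-! ### Deterministic inequalities for powers, roots and `ℓ_p` norms. -/

/-- For `r ≤ 1`, `s ^ r` lies between `1` and `s`; for `r ≥ 1` use Bernoulli, at `s⁻¹ - 1` when `s ≥
1`. No lower bound on `s` is needed, because it will be a ratio whose numerator, a random norm, may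
vanish. -/
theorem abs_rpow_sub_one_le {r s : ℝ} (hr : 0 ≤ r) (hs : 0 ≤ s) :
    |s ^ r - 1| ≤ (r + 1) * |s - 1| * (1 + s) ^ r := by
  have h1s : 1 ≤ (1 + s) ^ r := Real.one_le_rpow (by linarith) hr
  have key : |s ^ r - 1| ≤ max 1 r * |s - 1| * (1 + s) ^ r := by
    rcases le_total r 1 with h | h
    · rw [max_eq_left h, one_mul]
      have : |s ^ r - 1| ≤ |s - 1| := by
        rcases le_total 1 s with h1 | h1
        · rw [abs_of_nonneg (by linarith [Real.one_le_rpow h1 hr]), abs_of_nonneg (by linarith)]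
          linarith [Real.rpow_le_self_of_one_le h1 h]
        · rw [abs_of_nonpos (by linarith [Real.rpow_le_one hs h1 hr]), abs_of_nonpos (by linarith)]
          linarith [Real.self_le_rpow_of_le_one hs h1 h]
      nlinarith [abs_nonneg (s - 1)]
    · rw [max_eq_right h]
      rcases le_total 1 s with h1 | h1
      · have hs0 : 0 < s := by linarith
        rw [abs_of_nonneg (by linarith [Real.one_le_rpow h1 hr]), abs_of_nonneg (by linarith)]
        have hB := one_add_mul_self_le_rpow_one_add (s := s⁻¹ - 1) (p := r)
          (by linarith [inv_pos.2 hs0]) h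
        rw [add_sub_cancel, Real.inv_rpow hs] at hB
        have hsr : 0 < s ^ r := by positivity
        have h2 : s ^ r * (1 + r * (s⁻¹ - 1)) ≤ 1 := by
          calc _ ≤ s ^ r * (s ^ r)⁻¹ := by gcongr
            _ = 1 := mul_inv_cancel₀ hsr.ne'
        have h3 : s ^ r * (1 - s⁻¹) ≤ (s - 1) * (1 + s) ^ r := by
          calc s ^ r * (1 - s⁻¹) = s ^ r * s⁻¹ * (s - 1) := by field_simp
            _ ≤ s ^ r * 1 * (s - 1) := by
                gcongr
                exact inv_le_one_of_one_le₀ h1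
            _ ≤ (1 + s) ^ r * 1 * (s - 1) := by
                gcongr
                linarith
            _ = _ := by ring
        nlinarith
      · rw [abs_of_nonpos (by linarith [Real.rpow_le_one hs h1 hr]), abs_of_nonpos (by linarith)]
        have hB := one_add_mul_self_le_rpow_one_add (s := s - 1) (p := r) (by linarith) h
        rw [add_sub_cancel] at hB
        have : 0 ≤ r * -(s - 1) := mul_nonneg hr (by linarith)
        nlinarith
  refine key.trans ?_
  gcongr
  exact max_le (by linarith) (by linarith)

/-- For `x ≤ y`, `y ^ p - x ^ p ≥ (y - x) * y ^ (p - 1)`. Only the larger number enters the last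
factor, so it suffices that one of the two be at least `τ`. -/
theorem abs_sub_mul_rpow_le {p a b τ : ℝ} (hp : 1 ≤ p) (ha : 0 ≤ a) (hb : 0 ≤ b) (hτ : 0 ≤ τ)
    (h : τ ≤ b) : |a - b| * τ ^ (p - 1) ≤ |a ^ p - b ^ p| := by
  have main : ∀ x y : ℝ, 0 ≤ x → x ≤ y → τ ≤ y → (y - x) * τ ^ (p - 1) ≤ y ^ p - x ^ p := by
    intro x y hx hxy hy
    have hy0 : 0 ≤ y := hx.trans hxy
    have e : ∀ z : ℝ, 0 ≤ z → z ^ p = z * z ^ (p - 1) := by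
      intro z hz
      rw [← Real.rpow_one_add' hz (by linarith)]; ring_nf
    have h1 : x ^ (p - 1) ≤ y ^ (p - 1) := Real.rpow_le_rpow hx hxy (by linarith)
    have h2 : τ ^ (p - 1) ≤ y ^ (p - 1) := Real.rpow_le_rpow hτ hy (by linarith)
    rw [e x hx, e y hy0]
    nlinarith
  rcases le_total a b with hab | hab
  · rw [abs_sub_comm, abs_of_nonneg (sub_nonneg.2 hab), abs_sub_comm]
    exact (main a b ha hab h).trans (le_abs_self _)
  · rw [abs_of_nonneg (sub_nonneg.2 hab)]
    exact (main b a hb hab (h.trans hab)).trans (le_abs_self _)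

/-- Stability of the difference of two `p`-th roots. -/
theorem abs_sub_sub_sub_le {p a b a₀ b₀ τ M B : ℝ} (hp : 1 ≤ p) (ha : 0 ≤ a) (hb : 0 ≤ b)
    (hτ : 0 < τ) (ha₀ : τ ≤ a₀) (hb₀ : τ ≤ b₀) (haM : |a - a₀| ≤ M) (hbM : |b - b₀| ≤ M)
    (haB : a ≤ B) (hbB : b ≤ B) :
    |(a - b) - (a₀ - b₀)| ≤ |(a ^ p - b ^ p) - (a₀ ^ p - b₀ ^ p)| / τ ^ (p - 1) +
      p * |a - b| * (M / τ) * (1 + B / τ) ^ (p - 1) := by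
  have hd : ∀ s : ℝ, HasDerivAt
      (fun s => (b + s * (a - b)) ^ p - (b₀ + s * (a₀ - b₀)) ^ p)
      ((a - b) * p * (b + s * (a - b)) ^ (p - 1) -
        (a₀ - b₀) * p * (b₀ + s * (a₀ - b₀)) ^ (p - 1)) s := by
    intro s
    have h1 : HasDerivAt (fun s => b + s * (a - b)) (a - b) s := by
      simpa using ((hasDerivAt_id s).mul_const (a - b)).const_add b
    have h2 : HasDerivAt (fun s => b₀ + s * (a₀ - b₀)) (a₀ - b₀) s := by
      simpa using ((hasDerivAt_id s).mul_const (a₀ - b₀)).const_add b₀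
    exact (h1.rpow_const (Or.inr hp)).sub (h2.rpow_const (Or.inr hp))
  -- The mean value theorem is applied once, to the difference of the two powers. The intermediate
  -- points `z`, `z₀` then share the parameter `s`, which gives `|z - z₀| ≤ M`; only `z₀` is bounded
  -- below, so one divides by `z₀ ^ (p - 1)`.
  obtain ⟨s, ⟨hs0, hs1⟩, hs⟩ := exists_hasDerivAt_eq_slope _ _ (zero_lt_one' ℝ)
    (fun s _ => (hd s).continuousAt.continuousWithinAt) (fun s _ => hd s)
  simp only [one_mul, zero_mul, add_zero, sub_zero, div_one, add_sub_cancel] at hs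
  set z := b + s * (a - b) with hz
  set z₀ := b₀ + s * (a₀ - b₀) with hz₀
  have hs1' : 0 ≤ 1 - s := by linarith
  have hzn : 0 ≤ z := by
    have : z = (1 - s) * b + s * a := by rw [hz]; ring
    rw [this]; positivity
  have hzB : z ≤ B := by
    have : z = (1 - s) * b + s * a := by rw [hz]; ring
    nlinarith
  have hz₀τ : τ ≤ z₀ := by
    have : z₀ = (1 - s) * b₀ + s * a₀ := by rw [hz₀]; ring
    nlinarith
  have hzM : |z - z₀| ≤ M := by
    have : z - z₀ = (1 - s) * (b - b₀) + s * (a - a₀) := by rw [hz, hz₀]; ring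
    rw [this]
    calc _ ≤ |(1 - s) * (b - b₀)| + |s * (a - a₀)| := abs_add_le _ _
      _ = (1 - s) * |b - b₀| + s * |a - a₀| := by
          rw [abs_mul, abs_mul, abs_of_nonneg hs1', abs_of_pos hs0]
      _ ≤ (1 - s) * M + s * M := by gcongr
      _ = M := by ring
  have hz₀p : 0 < z₀ := by linarith
  have hzp : 0 < z₀ ^ (p - 1) := by positivity
  have hσ := abs_rpow_sub_one_le (r := p - 1) (s := z / z₀) (by linarith) (by positivity)
  rw [Real.div_rpow hzn hz₀p.le] at hσ
  have he : (a - b) - (a₀ - b₀) = ((a ^ p - b ^ p) - (a₀ ^ p - b₀ ^ p)) / (p * z₀ ^ (p - 1)) -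
      (a - b) * (z ^ (p - 1) / z₀ ^ (p - 1) - 1) := by
    have hs' : (a ^ p - b ^ p) - (a₀ ^ p - b₀ ^ p) =
        (a - b) * p * z ^ (p - 1) - (a₀ - b₀) * p * z₀ ^ (p - 1) := by rw [hs]; ring
    rw [hs']
    field_simp
    ring
  have hσ2 : |z / z₀ - 1| ≤ M / τ := by
    rw [div_sub_one hz₀p.ne', abs_div, abs_of_pos hz₀p]
    exact div_le_div₀ ((abs_nonneg _).trans hzM) hzM hτ hz₀τ
  have hσ3 : z / z₀ ≤ B / τ := div_le_div₀ (hzn.trans hzB) hzB hτ hz₀τ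
  rw [he]
  refine (abs_sub _ _).trans (add_le_add ?_ ?_)
  · rw [abs_div, abs_of_pos (show 0 < p * z₀ ^ (p - 1) by positivity)]
    apply div_le_div_of_nonneg_left (abs_nonneg _) (by positivity)
    have : τ ^ (p - 1) ≤ z₀ ^ (p - 1) := Real.rpow_le_rpow hτ.le hz₀τ (by linarith)
    nlinarith
  · rw [abs_mul]
    have hM : 0 ≤ M := (abs_nonneg _).trans hzM
    calc _ ≤ |a - b| * ((p - 1 + 1) * |z / z₀ - 1| * (1 + z / z₀) ^ (p - 1)) := by gcongr
      _ ≤ |a - b| * (p * (M / τ) * (1 + B / τ) ^ (p - 1)) := by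
          rw [sub_add_cancel]
          gcongr
      _ = _ := by ring

/-- The deterministic part of the increment bound, in the moderate deviation regime. -/
theorem increment_le_of_moderate {p a b α β σ L t δ θ K K' : ℝ} (hp : 1 ≤ p) (ha : 0 ≤ a)
    (hb : 0 ≤ b) (hσ : 0 < σ) (hL : 0 < L) (ht : 0 ≤ t) (hδ : 0 ≤ δ) (hθ : 0 < θ) (hθ1 : θ ≤ 1)
    (hK : 0 ≤ K) (hK' : 1 ≤ K') (hα : θ ≤ α) (hβ : θ ≤ β)
    (h₁ : |a ^ p - (σ * α) ^ p| ≤ K * t * σ ^ p / L)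
    (h₂ : |b ^ p - (σ * β) ^ p| ≤ K * t * σ ^ p / L)
    (h₃ : |(a ^ p - b ^ p) - ((σ * α) ^ p - (σ * β) ^ p)| ≤ p * δ * (K * t * σ ^ p / L))
    (haB : a ≤ K' * σ) (hbB : b ≤ K' * σ) (hab : |a - b| ≤ δ * (K' * σ)) :
    |a - σ * α| ≤ K * (σ / L) * θ ^ (-(2 * p - 1)) * t ∧
    |(a - b) - (σ * α - σ * β)| ≤
      (p * K + p * K' * K * (2 * K') ^ (p - 1)) * δ * (σ / L) * θ ^ (-(2 * p - 1)) * t := by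
  have hτ : 0 < σ * θ := by positivity
  have hα' : σ * θ ≤ σ * α := by gcongr
  have hβ' : σ * θ ≤ σ * β := by gcongr
  have hσp : σ ^ p = σ * σ ^ (p - 1) := by
    rw [← Real.rpow_one_add' hσ.le (by linarith)]; ring_nf
  have hθp : 0 < θ ^ (p - 1) := by positivity
  have hτp : (σ * θ) ^ (p - 1) = σ ^ (p - 1) * θ ^ (p - 1) := Real.mul_rpow hσ.le hθ.le
  have hσp1 : 0 < σ ^ (p - 1) := by positivity
  have hdiv : K * t * σ ^ p / L / (σ * θ) ^ (p - 1) = K * (σ / L) * (θ ^ (p - 1))⁻¹ * t := by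
    rw [hτp, hσp]; field_simp
  have hM : ∀ x γ : ℝ, 0 ≤ x → θ ≤ γ → |x ^ p - (σ * γ) ^ p| ≤ K * t * σ ^ p / L →
      |x - σ * γ| ≤ K * (σ / L) * (θ ^ (p - 1))⁻¹ * t := by
    intro x γ hx hγ h
    rw [← hdiv, le_div_iff₀ (by positivity)]
    exact (abs_sub_mul_rpow_le hp hx (by nlinarith) hτ.le (by gcongr)).trans h
  have hθinv : (θ ^ (p - 1))⁻¹ ≤ θ ^ (-(2 * p - 1)) := by
    rw [← Real.rpow_neg hθ.le]
    exact Real.rpow_le_rpow_of_exponent_ge hθ hθ1 (by linarith)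
  have hσL : 0 ≤ σ / L := by positivity
  refine ⟨(hM a α ha hα h₁).trans (by gcongr), ?_⟩
  have hinc := abs_sub_sub_sub_le (B := K' * σ) hp ha hb hτ hα' hβ' (hM a α ha hα h₁)
    (hM b β hb hβ h₂) haB hbB
  refine hinc.trans ?_
  have hfirst : |(a ^ p - b ^ p) - ((σ * α) ^ p - (σ * β) ^ p)| / (σ * θ) ^ (p - 1) ≤
      p * K * δ * (σ / L) * θ ^ (-(2 * p - 1)) * t := by
    calc _ ≤ p * δ * (K * t * σ ^ p / L) / (σ * θ) ^ (p - 1) := by gcongr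
      _ = p * δ * (K * t * σ ^ p / L / (σ * θ) ^ (p - 1)) := by ring
      _ = p * K * δ * (σ / L) * (θ ^ (p - 1))⁻¹ * t := by rw [hdiv]; ring
      _ ≤ _ := by gcongr
  have hB : 1 + K' * σ / (σ * θ) ≤ 2 * K' * θ⁻¹ := by
    have : K' * σ / (σ * θ) = K' * θ⁻¹ := by field_simp
    have h2 : 1 ≤ θ⁻¹ := (one_le_inv₀ hθ).2 hθ1
    rw [this]; nlinarith
  -- Origin of the exponent `2 * p - 1`: `p - 1` from the bound on `|a - σ * α|`, one from dividing
  -- it by `σ * θ`, and `p - 1` from the last factor.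
  have hsecond : p * |a - b| * (K * (σ / L) * (θ ^ (p - 1))⁻¹ * t / (σ * θ)) *
      (1 + K' * σ / (σ * θ)) ^ (p - 1) ≤
      p * K' * K * (2 * K') ^ (p - 1) * δ * (σ / L) * θ ^ (-(2 * p - 1)) * t := by
    calc _ ≤ p * (δ * (K' * σ)) * (K * (σ / L) * (θ ^ (p - 1))⁻¹ * t / (σ * θ)) *
        (2 * K' * θ⁻¹) ^ (p - 1) := by gcongr
      _ = p * K' * K * (2 * K') ^ (p - 1) * δ * (σ / L) *
          ((θ ^ (p - 1))⁻¹ * θ⁻¹ * (θ ^ (p - 1))⁻¹) * t := by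
          rw [Real.mul_rpow (by positivity) (by positivity), Real.inv_rpow hθ.le]
          field_simp
      _ = _ := by
          congr 2
          rw [← Real.rpow_neg hθ.le, ← Real.rpow_neg_one θ, ← Real.rpow_add hθ,
            ← Real.rpow_add hθ]
          congr 1; ring
  calc _ ≤ _ := add_le_add hfirst hsecond
    _ = _ := by ring

/-- Bernoulli's inequality at `x / y - 1` replaces the mean value theorem. -/
theorem abs_rpow_sub_rpow_le {p x y M : ℝ} (hp : 1 ≤ p) (hx : 0 ≤ x) (hy : 0 ≤ y) (hxM : x ≤ M)
    (hyM : y ≤ M) : |x ^ p - y ^ p| ≤ p * |x - y| * M ^ (p - 1) := by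
  have main : ∀ x y : ℝ, 0 ≤ x → x ≤ y → y ≤ M → y ^ p - x ^ p ≤ p * (y - x) * M ^ (p - 1) := by
    intro x y hx hxy hyM
    rcases (hx.trans hxy).eq_or_lt with h0 | h0
    · have : x = 0 := by linarith
      simp [this, ← h0]
    have hB := one_add_mul_self_le_rpow_one_add (s := x / y - 1) (p := p)
      (by linarith [div_nonneg hx h0.le]) hp
    rw [add_sub_cancel, Real.div_rpow hx h0.le] at hB
    have hyp : 0 < y ^ p := by positivity
    have hyp1 : y ^ p = y ^ (p - 1) * y := by
      rw [← Real.rpow_add_one h0.ne']; ring_nf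
    rw [le_div_iff₀ hyp] at hB
    have h2 : (1 + p * (x / y - 1)) * y ^ p = y ^ p - p * (y - x) * y ^ (p - 1) := by
      rw [hyp1]; field_simp; ring
    rw [h2] at hB
    have h3 : y ^ (p - 1) ≤ M ^ (p - 1) := Real.rpow_le_rpow h0.le hyM (by linarith)
    have h4 : 0 ≤ p * (y - x) := mul_nonneg (by linarith) (by linarith)
    nlinarith
  rcases le_total x y with h | h
  · rw [abs_sub_comm, abs_sub_comm x, abs_of_nonneg (sub_nonneg.2 h), abs_of_nonneg (sub_nonneg.2
      (Real.rpow_le_rpow hx h (by linarith)))]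
    exact main x y hx h hyM
  · rw [abs_of_nonneg (sub_nonneg.2 h), abs_of_nonneg (sub_nonneg.2
      (Real.rpow_le_rpow hy h (by linarith)))]
    exact main y x hy h hxM

/-- Power mean inequality on `m` coordinates. It brings in the factor `m ^ (1/p - 1/P)`, the sum of
the `Y i ^ P` being the one whose size is controlled by concentration. -/
theorem sum_rpow_rpow_inv_le {m : ℕ} [NeZero m] {p P : ℝ} (hp : 0 < p) (hpP : p ≤ P)
    {z Y : Fin m → ℝ} (h : ∀ i, |z i| ≤ Y i) :
    (∑ i, |z i| ^ p) ^ (1 / p) ≤ (m : ℝ) ^ (1 / p - 1 / P) * (∑ i, Y i ^ P) ^ (1 / P) := by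
  have hm : 0 < (m : ℝ) := by exact_mod_cast Nat.pos_of_ne_zero (NeZero.ne m)
  have hP : 0 < P := by linarith
  have hY : ∀ i, 0 ≤ Y i := fun i => (abs_nonneg _).trans (h i)
  have h1 := Real.rpow_sum_le_const_mul_sum_rpow (s := (Finset.univ : Finset (Fin m)))
    (fun i => Y i ^ p) (p := P / p) ((one_le_div hp).2 hpP)
  have h2 : ∀ i, |Y i ^ p| = Y i ^ p := fun i => abs_of_nonneg (Real.rpow_nonneg (hY i) _)
  have h3 : ∀ i, (Y i ^ p) ^ (P / p) = Y i ^ P := fun i => by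
    rw [← Real.rpow_mul (hY i)]; congr 1; field_simp
  simp only [h2, h3, Finset.card_univ, Fintype.card_fin] at h1
  have hS : 0 ≤ ∑ i, Y i ^ p := Finset.sum_nonneg fun i _ => Real.rpow_nonneg (hY i) _
  have hS' : 0 ≤ ∑ i, Y i ^ P := Finset.sum_nonneg fun i _ => Real.rpow_nonneg (hY i) _
  calc (∑ i, |z i| ^ p) ^ (1 / p) ≤ (∑ i, Y i ^ p) ^ (1 / p) := by
        gcongr with i
        exact h i
    _ = ((∑ i, Y i ^ p) ^ (P / p)) ^ (1 / P) := by
        rw [← Real.rpow_mul hS]; congr 1; field_simp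
    _ ≤ ((m : ℝ) ^ (P / p - 1) * ∑ i, Y i ^ P) ^ (1 / P) := by gcongr
    _ = _ := by
        rw [Real.mul_rpow (by positivity) hS', ← Real.rpow_mul hm.le]
        congr 2
        field_simp

theorem abs_sum_rpow_sub_le {m : ℕ} {p : ℝ} (hp : 1 ≤ p) (u v : Fin m → ℝ) :
    |(∑ i, |u i| ^ p) ^ (1 / p) - (∑ i, |v i| ^ p) ^ (1 / p)| ≤
      (∑ i, |u i - v i| ^ p) ^ (1 / p) := by
  have h1 := Real.Lp_add_le Finset.univ v (fun i => u i - v i) hp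
  have h2 := Real.Lp_add_le Finset.univ u (fun i => v i - u i) hp
  simp only [add_sub_cancel] at h1 h2
  have h3 : ∀ i, |v i - u i| = |u i - v i| := fun i => abs_sub_comm _ _
  simp only [h3] at h2
  rw [abs_le]
  constructor <;> linarith

/-- The deterministic part of the increment bound, in the large deviation regime. -/
theorem increment_le_of_large {a b α β σ r δ Θ K A B : ℝ} (ha : 0 ≤ a) (hα : 0 ≤ α)
    (hσ : 0 ≤ σ) (hδ : 0 ≤ δ) (hK : 0 ≤ K) (hΘ : 1 ≤ Θ) (hσr : σ ≤ r) (har : a ≤ K * r)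
    (hαA : α ≤ A) (hab : |a - b| ≤ δ * (K * r)) (hαβ : |α - β| ≤ B * δ * Θ) :
    |a - σ * α| ≤ (K + A) * r * Θ ∧
    |(a - b) - (σ * α - σ * β)| ≤ (K + B) * δ * r * Θ := by
  have hr : 0 ≤ r := hσ.trans hσr
  have hA : 0 ≤ A := hα.trans hαA
  constructor
  · have e1 : |a - σ * α| ≤ (K + A) * r := by
      have e2 : σ * α ≤ r * A := by gcongr
      have e3 : 0 ≤ σ * α := by positivity
      have e4 : 0 ≤ K * r := by positivity
      have e5 : 0 ≤ r * A := by positivity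
      rw [abs_le]
      constructor <;> linarith
    exact e1.trans (le_mul_of_one_le_right (by positivity) hΘ)
  · have e1 : |(a - b) - (σ * α - σ * β)| ≤ δ * (K * r) + r * (B * δ * Θ) := by
      refine (abs_sub _ _).trans (add_le_add hab ?_)
      rw [← mul_sub, abs_mul, abs_of_nonneg hσ]
      gcongr
    have e2 : δ * (K * r) ≤ δ * (K * r) * Θ := le_mul_of_one_le_right (by positivity) hΘ
    linarith

/-! ### Tails of `ℓ_p` norms and of their increments. -/

set_option maxHeartbeats 1600000 in
/-- Tail bounds for the centred `ℓ_p` norm of a vector with independent coordinates, and for the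
increments of such norms. -/
theorem exists_measure_lp_increment_le (p : ℝ) (hp : 1 ≤ p) :
    ∃ C : ℝ, 1 ≤ C ∧ ∀ {Ω : Type*} [MeasurableSpace Ω] (μ : Measure Ω) [IsProbabilityMeasure μ]
      {m : ℕ} [NeZero m] (u v w : Fin m → Ω → ℝ) (δ α β θ : ℝ),
      (∀ i, Measurable (u i)) → (∀ i, Measurable (v i)) → (∀ i, Measurable (w i)) → 0 ≤ δ →
      (∀ i ω, u i ω - v i ω = δ * w i ω) → iIndepFun (fun i ω => (u i ω, v i ω, w i ω)) μ →
      (∀ i, Integrable (fun ω => Real.exp ((|u i ω| + |v i ω| + |w i ω|) ^ 2)) μ) →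
      (∀ i, ∫ ω, Real.exp ((|u i ω| + |v i ω| + |w i ω|) ^ 2) ∂μ ≤ 2) →
      0 < θ → θ ≤ 1 → θ ≤ α → θ ≤ β → (∀ i, ∫ ω, |u i ω| ^ p ∂μ = α ^ p) →
      (∀ i, ∫ ω, |v i ω| ^ p ∂μ = β ^ p) → ∀ t : ℝ, 1 ≤ t →
      μ.real {ω |
        C * (m : ℝ) ^ (1 / p - 1 / max p 2) * θ ^ (-(2 * p - 1)) * t <
          |(∑ i, |u i ω| ^ p) ^ (1 / p) - (m : ℝ) ^ (1 / p) * α| ∨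
        C * δ * (m : ℝ) ^ (1 / p - 1 / max p 2) * θ ^ (-(2 * p - 1)) * t <
          |((∑ i, |u i ω| ^ p) ^ (1 / p) - (∑ i, |v i ω| ^ p) ^ (1 / p)) -
            ((m : ℝ) ^ (1 / p) * α - (m : ℝ) ^ (1 / p) * β)|} ≤ C * Real.exp (-(t ^ 2 / 2)) := by
  set P := max p 2 with hPdef
  have hP2 : 2 ≤ P := le_max_right _ _
  have hpP : p ≤ P := le_max_left _ _
  obtain ⟨K, hK, hconc⟩ := exists_measure_abs_sum_sub_le P hP2
  obtain ⟨C₁, hC₁, hC₁'⟩ := exists_rpow_le_mul_exp_sq P 1 (by linarith) one_pos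
  set K' := 4 * C₁ + K with hK'
  have hK'1 : 1 ≤ K' := by linarith
  set K₂ := p * K + p * K' * K * (2 * K') ^ (p - 1) with hK₂
  have hK₂0 : 0 ≤ K₂ := by positivity
  obtain ⟨C, hC1, hC2, hKC, hKC₂, hC3, hC4⟩ : ∃ C : ℝ, 1 ≤ C ∧ 4 * K ≤ C ∧ K ≤ C ∧ K₂ ≤ C ∧
      K' + 4 * C₁ ≤ C ∧ K' + 4 * C₁ * p ≤ C := by
    have h1 : 0 ≤ C₁ * p := by positivity
    refine ⟨4 * K + K' + 4 * C₁ * p + K₂ + 4 * C₁, ?_, ?_, ?_, ?_, ?_, ?_⟩ <;> linarith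
  refine ⟨C, hC1, ?_⟩
  clear_value P
  intro Ω _ μ _ m _ u v w δ α β θ hum hvm hwm hδ huv hind hint hE hθ hθ1 hα hβ hEu hEv t ht
  have hm1 : 1 ≤ (m : ℝ) := by exact_mod_cast Nat.pos_of_ne_zero (NeZero.ne m)
  have hm : 0 < (m : ℝ) := by linarith
  set Y : Fin m → Ω → ℝ := fun i ω => |u i ω| + |v i ω| + |w i ω| with hY
  have hYm : ∀ i, Measurable (Y i) := fun i => by fun_prop
  have hY0 : ∀ i ω, 0 ≤ Y i ω := fun i ω => by positivity
  have huY : ∀ i ω, |u i ω| ≤ Y i ω := fun i ω => by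
    linarith [abs_nonneg (v i ω), abs_nonneg (w i ω)]
  have hvY : ∀ i ω, |v i ω| ≤ Y i ω := fun i ω => by
    linarith [abs_nonneg (u i ω), abs_nonneg (w i ω)]
  have hwY : ∀ i ω, |w i ω| ≤ Y i ω := fun i ω => by
    linarith [abs_nonneg (u i ω), abs_nonneg (v i ω)]
  have hYpP : ∀ i ω, Y i ω ^ p ≤ 1 + Y i ω ^ P := by
    intro i ω
    rcases le_total (Y i ω) 1 with h | h
    · linarith [Real.rpow_le_one (hY0 i ω) h (show 0 ≤ p by linarith),
        Real.rpow_nonneg (hY0 i ω) P]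
    · linarith [Real.rpow_le_rpow_of_exponent_le h hpP]
  have hYP0 : ∀ i ω, 0 ≤ Y i ω ^ P := fun i ω => Real.rpow_nonneg (hY0 i ω) _
  have hYPexp : ∀ i ω, 1 + Y i ω ^ P ≤ 2 * C₁ * Real.exp (Y i ω ^ 2) := by
    intro i ω
    have h1 := hC₁' _ (hY0 i ω)
    rw [one_mul] at h1
    have h2 : 1 ≤ Real.exp (Y i ω ^ 2) := Real.one_le_exp (by positivity)
    nlinarith
  -- the four sums
  set ξ : Fin m → Ω → ℝ := fun i ω => (|u i ω| ^ p - |v i ω| ^ p) / (p * δ) with hξ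
  have hup : ∀ i ω, |(|u i ω| ^ p)| ≤ 1 + Y i ω ^ P := fun i ω => by
    rw [abs_of_nonneg (by positivity)]
    exact (Real.rpow_le_rpow (abs_nonneg _) (huY i ω) (by linarith)).trans (hYpP i ω)
  have hvp : ∀ i ω, |(|v i ω| ^ p)| ≤ 1 + Y i ω ^ P := fun i ω => by
    rw [abs_of_nonneg (by positivity)]
    exact (Real.rpow_le_rpow (abs_nonneg _) (hvY i ω) (by linarith)).trans (hYpP i ω)
  -- Since `|u| - |v|` is at most `δ * |w|` in absolute value, the increments of the `p`-th powers
  -- carry a factor `δ`; divided by `p * δ` they fall under the same concentration bound, uniformly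
  -- in `δ`.
  have huvp : ∀ i ω, |(|u i ω| ^ p - |v i ω| ^ p)| ≤ p * δ * (1 + Y i ω ^ P) := by
    intro i ω
    have h1 := abs_rpow_sub_rpow_le hp (abs_nonneg (u i ω)) (abs_nonneg (v i ω)) (huY i ω)
      (hvY i ω)
    have h2 : |(|u i ω| - |v i ω|)| ≤ δ * Y i ω := by
      refine (abs_abs_sub_abs_le_abs_sub _ _).trans ?_
      rw [huv i ω, abs_mul, abs_of_nonneg hδ]
      gcongr
      exact hwY i ω
    have h3 : Y i ω * Y i ω ^ (p - 1) = Y i ω ^ p := by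
      rw [← Real.rpow_one_add' (hY0 i ω) (by linarith)]; ring_nf
    have h4 : 0 ≤ Y i ω ^ (p - 1) := Real.rpow_nonneg (hY0 i ω) _
    calc _ ≤ p * |(|u i ω| - |v i ω|)| * Y i ω ^ (p - 1) := h1
      _ ≤ p * (δ * Y i ω) * Y i ω ^ (p - 1) := by gcongr
      _ = p * δ * Y i ω ^ p := by rw [← h3]; ring
      _ ≤ _ := by gcongr; exact hYpP i ω
  have hξp : ∀ i ω, |ξ i ω| ≤ 1 + Y i ω ^ P := by
    intro i ω
    rcases hδ.eq_or_lt with h0 | h0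
    · simp only [hξ, ← h0, mul_zero, div_zero, abs_zero]
      linarith [hYP0 i ω]
    · have hpd : 0 < p * δ := by positivity
      simp only [hξ]
      rw [abs_div, abs_of_pos hpd, div_le_iff₀ hpd, mul_comm]
      exact huvp i ω
  have hYPabs : ∀ i ω, |Y i ω ^ P| ≤ 1 + Y i ω ^ P := fun i ω => by
    rw [abs_of_nonneg (hYP0 i ω)]; linarith
  -- For `δ = 0` the quotient `ξ` is zero by convention, and the identity persists because `u = v`.
  have hξu : ∀ i ω, |u i ω| ^ p - |v i ω| ^ p = p * δ * ξ i ω := by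
    intro i ω
    rcases hδ.eq_or_lt with h0 | h0
    · have := huv i ω
      rw [← h0, zero_mul, sub_eq_zero] at this
      simp [this, ← h0]
    · simp only [hξ]; field_simp
  have hum' : ∀ i, Measurable (fun ω => |u i ω| ^ p) := fun i => by fun_prop
  have hvm' : ∀ i, Measurable (fun ω => |v i ω| ^ p) := fun i => by fun_prop
  have hξm : ∀ i, Measurable (ξ i) := fun i => by fun_prop
  have hYPm : ∀ i, Measurable (fun ω => Y i ω ^ P) := fun i => by fun_prop
  have hindY : ∀ g : ℝ × ℝ × ℝ → ℝ, Measurable g →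
      iIndepFun (fun i ω => (g (u i ω, v i ω, w i ω), Y i ω)) μ := fun g hg =>
    hind.comp (fun _ z => (g z, |z.1| + |z.2.1| + |z.2.2|)) (fun _ => by fun_prop)
  have hEabs : ∀ i (f : Ω → ℝ), Measurable f → (∀ ω, |f ω| ≤ 1 + Y i ω ^ P) →
      ∫ ω, |f ω| ∂μ ≤ 4 * C₁ := fun i f hf h =>
    (integral_le_of_le_mul_exp_sq hf (by linarith) (hint i) (hE i)
      fun ω => (h ω).trans (hYPexp i ω)).trans_eq (by ring)
  have hI : ∀ i (f : Ω → ℝ), Measurable f → (∀ ω, |f ω| ≤ 1 + Y i ω ^ P) → Integrable f μ :=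
    fun i f hf h => integrable_of_abs_le_mul_exp_sq hf (hint i)
      fun ω => (h ω).trans (hYPexp i ω)
  have hα0 : 0 < α := by linarith
  have hβ0 : 0 < β := by linarith
  have hα1 : α ≤ 4 * C₁ := by
    have h1 : α ^ p ≤ 4 * C₁ := by
      rw [← hEu 0]
      refine le_trans (le_of_eq ?_) (hEabs 0 _ (hum' 0) (hup 0))
      exact integral_congr_ae (Filter.Eventually.of_forall fun ω =>
        (abs_of_nonneg (by positivity)).symm)
    rcases le_total α 1 with h | h
    · linarith
    · exact (Real.self_le_rpow_of_one_le h hp).trans h1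
  have hαβ : |α - β| ≤ 4 * C₁ * p * δ * θ ^ (-(2 * p - 1)) := by
    have h1 : |α ^ p - β ^ p| ≤ p * δ * (4 * C₁) := by
      rw [← hEu 0, ← hEv 0, ← integral_sub (hI 0 _ (hum' 0) (hup 0)) (hI 0 _ (hvm' 0) (hvp 0))]
      simp only [hξu]
      rw [integral_const_mul, abs_mul, abs_of_nonneg (show 0 ≤ p * δ by positivity)]
      gcongr
      exact abs_integral_le_integral_abs.trans (hEabs 0 _ (hξm 0) (hξp 0))
    have h2 := (abs_sub_mul_rpow_le hp hα0.le hβ0.le hθ.le hβ).trans h1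
    rw [← le_div_iff₀ (by positivity)] at h2
    have h3 : (θ ^ (p - 1))⁻¹ ≤ θ ^ (-(2 * p - 1)) := by
      rw [← Real.rpow_neg hθ.le]
      exact Real.rpow_le_rpow_of_exponent_ge hθ hθ1 (by linarith)
    calc |α - β| ≤ p * δ * (4 * C₁) / θ ^ (p - 1) := h2
      _ = 4 * C₁ * p * δ * (θ ^ (p - 1))⁻¹ := by rw [div_eq_mul_inv]; ring
      _ ≤ _ := by gcongr
  set T := (m : ℝ) ^ (1 / P) with hT
  set ρ := (m : ℝ) ^ (1 / p - 1 / P) with hρ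
  set σ := (m : ℝ) ^ (1 / p) with hσ
  have hσρ : σ = ρ * T := by
    rw [hσ, hρ, hT, ← Real.rpow_add hm]; ring_nf
  have hρ0 : 0 < ρ := by positivity
  have hσ0 : 0 < σ := by positivity
  have hT1 : 1 ≤ T := Real.one_le_rpow hm1 (by positivity)
  have hTP : T ^ P = m := by
    rw [hT, ← Real.rpow_mul hm.le, one_div_mul_cancel (by linarith), Real.rpow_one]
  have hσp : σ ^ p = m := by
    rw [hσ, ← Real.rpow_mul hm.le, one_div_mul_cancel (by linarith), Real.rpow_one]
  clear_value T ρ σ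
  -- The least level with both `t ≤ L` and `m ≤ L ^ P`.
  set L := max t T with hL
  have htL : t ≤ L := le_max_left _ _
  have hTL : T ≤ L := le_max_right _ _
  have hL0 : 0 < L := by linarith
  have hmL : (m : ℝ) ≤ L ^ P := by
    rw [← hTP]; exact Real.rpow_le_rpow (by positivity) hTL (by linarith)
  have hcard : (Fintype.card (Fin m) : ℝ) ≤ L ^ P := by simpa using hmL
  have c1 := hconc μ Y (fun i ω => |u i ω| ^ p) hYm hum' hY0 hup hint hE
    (hindY (fun z => |z.1| ^ p) (by fun_prop)) t L ht htL hcard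
  have c2 := hconc μ Y (fun i ω => |v i ω| ^ p) hYm hvm' hY0 hvp hint hE
    (hindY (fun z => |z.2.1| ^ p) (by fun_prop)) t L ht htL hcard
  have c3 := hconc μ Y ξ hYm hξm hY0 hξp hint hE
    (hindY (fun z => (|z.1| ^ p - |z.2.1| ^ p) / (p * δ)) (by fun_prop)) t L ht htL hcard
  have c4 := hconc μ Y (fun i ω => Y i ω ^ P) hYm hYPm hY0 hYPabs hint hE
    (hindY (fun z => (|z.1| + |z.2.1| + |z.2.2|) ^ P) (by fun_prop)) t L ht htL hcard
  have hLP : L ^ P = L ^ (P - 1) * L := by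
    rw [← Real.rpow_add_one hL0.ne']; ring_nf
  have hθ2 : 1 ≤ θ ^ (-(2 * p - 1)) :=
    Real.one_le_rpow_of_pos_of_le_one_of_nonpos hθ hθ1 (by linarith)
  -- Outside four exceptional events, for `|u| ^ p`, `|v| ^ p`, their scaled difference and `Y ^ P`,
  -- both bounds hold deterministically.
  have hsub : {ω |
        C * ρ * θ ^ (-(2 * p - 1)) * t < |(∑ i, |u i ω| ^ p) ^ (1 / p) - σ * α| ∨
        C * δ * ρ * θ ^ (-(2 * p - 1)) * t <
          |((∑ i, |u i ω| ^ p) ^ (1 / p) - (∑ i, |v i ω| ^ p) ^ (1 / p)) -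
            (σ * α - σ * β)|} ⊆
      ({ω | K * (t * L ^ (P - 1)) ≤ |∑ i, |u i ω| ^ p - ∑ i, ∫ ω', |u i ω'| ^ p ∂μ|} ∪
       {ω | K * (t * L ^ (P - 1)) ≤ |∑ i, |v i ω| ^ p - ∑ i, ∫ ω', |v i ω'| ^ p ∂μ|}) ∪
      ({ω | K * (t * L ^ (P - 1)) ≤ |∑ i, ξ i ω - ∑ i, ∫ ω', ξ i ω' ∂μ|} ∪
       {ω | K * (t * L ^ (P - 1)) ≤ |∑ i, Y i ω ^ P - ∑ i, ∫ ω', Y i ω' ^ P ∂μ|}) := by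
    intro ω
    contrapose
    simp only [Set.mem_union, Set.mem_ofPred_eq, not_or, not_le, not_lt]
    rintro ⟨⟨h1, h2⟩, h3, h4⟩
    obtain ⟨a, ha⟩ : ∃ a, a = (∑ i, |u i ω| ^ p) ^ (1 / p) := ⟨_, rfl⟩
    obtain ⟨b, hb⟩ : ∃ b, b = (∑ i, |v i ω| ^ p) ^ (1 / p) := ⟨_, rfl⟩
    have hsu : 0 ≤ ∑ i, |u i ω| ^ p := Finset.sum_nonneg fun i _ => by positivity
    have hsv : 0 ≤ ∑ i, |v i ω| ^ p := Finset.sum_nonneg fun i _ => by positivity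
    have hsY : 0 ≤ ∑ i, Y i ω ^ P := Finset.sum_nonneg fun i _ => hYP0 i ω
    have ha0 : 0 ≤ a := ha ▸ Real.rpow_nonneg hsu _
    have hb0 : 0 ≤ b := hb ▸ Real.rpow_nonneg hsv _
    have hap : a ^ p = ∑ i, |u i ω| ^ p := by
      rw [ha, ← Real.rpow_mul hsu, one_div_mul_cancel (by linarith), Real.rpow_one]
    have hbp : b ^ p = ∑ i, |v i ω| ^ p := by
      rw [hb, ← Real.rpow_mul hsv, one_div_mul_cancel (by linarith), Real.rpow_one]
    have hLP1 : 0 ≤ L ^ (P - 1) := by positivity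
    -- the size of the dominating vector
    have hYsum : (∑ i, Y i ω ^ P) ^ (1 / P) ≤ K' * L := by
      have e1 : ∑ i, ∫ ω', Y i ω' ^ P ∂μ ≤ m * (4 * C₁) := by
        calc _ ≤ ∑ i : Fin m, 4 * C₁ := Finset.sum_le_sum fun i _ =>
              (le_abs_self _).trans (abs_integral_le_integral_abs.trans
                (hEabs i _ (hYPm i) (hYPabs i)))
          _ = _ := by simp
      have e2 : ∑ i, Y i ω ^ P ≤ K' * L ^ P := by
        have e3 : K * (t * L ^ (P - 1)) ≤ K * L ^ P := by
          rw [hLP]; nlinarith [mul_le_mul_of_nonneg_right htL hLP1]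
        have e4 : (m : ℝ) * (4 * C₁) ≤ L ^ P * (4 * C₁) := by gcongr
        have := (abs_lt.1 h4).2
        rw [hK']; linarith
      calc _ ≤ (K' * L ^ P) ^ (1 / P) := by gcongr
        _ = K' ^ (1 / P) * L := by
          rw [Real.mul_rpow (by positivity) (by positivity), ← Real.rpow_mul hL0.le,
            mul_one_div_cancel (by linarith), Real.rpow_one]
        _ ≤ K' * L := by
          gcongr
          exact Real.rpow_le_self_of_one_le hK'1 ((div_le_one (by linarith)).2 (by linarith))
    have hnorm : ∀ z : Fin m → ℝ, (∀ i, |z i| ≤ Y i ω) →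
        (∑ i, |z i| ^ p) ^ (1 / p) ≤ K' * (ρ * L) := by
      intro z hz
      calc _ ≤ _ := sum_rpow_rpow_inv_le (by linarith) hpP hz
        _ ≤ ρ * (K' * L) := by rw [hρ]; gcongr
        _ = _ := by ring
    have haB : a ≤ K' * (ρ * L) := ha ▸ hnorm _ fun i => huY i ω
    have hbB : b ≤ K' * (ρ * L) := hb ▸ hnorm _ fun i => hvY i ω
    have hab : |a - b| ≤ δ * (K' * (ρ * L)) := by
      rw [ha, hb]
      refine (abs_sum_rpow_sub_le hp (fun i => u i ω) (fun i => v i ω)).trans ?_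
      have e1 : ∀ i, |u i ω - v i ω| ^ p = δ ^ p * |w i ω| ^ p := fun i => by
        rw [huv i ω, abs_mul, abs_of_nonneg hδ, Real.mul_rpow hδ (abs_nonneg _)]
      simp only [e1, ← Finset.mul_sum]
      rw [Real.mul_rpow (by positivity) (Finset.sum_nonneg fun i _ => by positivity),
        ← Real.rpow_mul hδ, mul_one_div_cancel (by linarith), Real.rpow_one]
      gcongr
      exact hnorm _ fun i => hwY i ω
    rw [← ha, ← hb]
    clear ha hb hnorm hYsum c1 c2 c3 c4
    -- If `t ≤ T`, then `L = T` and the deviation of the `p`-th powers is `K * t * σ ^ p / L`;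
    -- taking roots divides by `σ ^ (p - 1)` and leaves `(σ / L) * t = ρ * t`. If `t ≥ T`, then `σ =
    -- ρ * T ≤ ρ * t`, and the size bounds `haB` and `hab` suffice.
    rcases le_total t T with htT | htT
    · have hLT : L = T := max_eq_right htT
      have hσL : σ / L = ρ := by rw [hσρ, hLT]; field_simp
      have hρL : ρ * L = σ := by rw [hσρ, hLT]
      have e1 : K * (t * L ^ (P - 1)) = K * t * σ ^ p / L := by
        rw [hσp, ← hTP, ← hLT, hLP]; field_simp
      have hE₁ : ∑ i, ∫ ω', |u i ω'| ^ p ∂μ = (σ * α) ^ p := by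
        simp only [hEu]
        rw [Real.mul_rpow hσ0.le hα0.le, hσp]; simp
      have hE₂ : ∑ i, ∫ ω', |v i ω'| ^ p ∂μ = (σ * β) ^ p := by
        simp only [hEv]
        rw [Real.mul_rpow hσ0.le hβ0.le, hσp]; simp
      have hE₃ : p * δ * ∑ i, ∫ ω', ξ i ω' ∂μ = (σ * α) ^ p - (σ * β) ^ p := by
        rw [← hE₁, ← hE₂, ← Finset.sum_sub_distrib, Finset.mul_sum]
        refine Finset.sum_congr rfl fun i _ => ?_
        rw [← integral_const_mul, ← integral_sub (hI i _ (hum' i) (hup i))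
          (hI i _ (hvm' i) (hvp i))]
        simp only [hξu]
      rw [hE₁, ← hap, e1] at h1
      rw [hE₂, ← hbp, e1] at h2
      rw [e1] at h3
      have h3' : |(a ^ p - b ^ p) - ((σ * α) ^ p - (σ * β) ^ p)| ≤
          p * δ * (K * t * σ ^ p / L) := by
        have e2 : a ^ p - b ^ p = p * δ * ∑ i, ξ i ω := by
          rw [hap, hbp, ← Finset.sum_sub_distrib, Finset.mul_sum]
          exact Finset.sum_congr rfl fun i _ => hξu i ω
        rw [← hE₃, e2, ← mul_sub, abs_mul, abs_of_nonneg (show 0 ≤ p * δ by positivity)]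
        gcongr
      rw [hρL] at haB hbB hab
      have := increment_le_of_moderate hp ha0 hb0 hσ0 hL0 (by linarith) hδ hθ hθ1 (by linarith)
        hK'1 hα hβ h1.le h2.le h3' haB hbB hab
      rw [hσL] at this
      refine ⟨this.1.trans ?_, this.2.trans ?_⟩
      · gcongr
      · gcongr
    · have hLt : L = t := max_eq_left htT
      rw [hLt] at haB hab
      have hσt : σ ≤ ρ * t := by rw [hσρ]; gcongr
      have hθ3 : 0 ≤ θ ^ (-(2 * p - 1)) := by linarith
      have := increment_le_of_large ha0 hα0.le hσ0.le hδ (by linarith) hθ2 hσt haB hα1 hab hαβ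
      have ht0 : 0 ≤ t := by linarith
      refine ⟨this.1.trans ?_, this.2.trans ?_⟩
      · calc (K' + 4 * C₁) * (ρ * t) * θ ^ (-(2 * p - 1)) ≤
            C * (ρ * t) * θ ^ (-(2 * p - 1)) := by gcongr
          _ = _ := by ring
      · calc (K' + 4 * C₁ * p) * δ * (ρ * t) * θ ^ (-(2 * p - 1)) ≤
            C * δ * (ρ * t) * θ ^ (-(2 * p - 1)) := by gcongr
          _ = _ := by ring
  calc _ ≤ _ := measureReal_mono hsub
    _ ≤ _ := measureReal_union_le _ _
    _ ≤ (K * Real.exp (-(t ^ 2 / 2)) + K * Real.exp (-(t ^ 2 / 2))) +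
        (K * Real.exp (-(t ^ 2 / 2)) + K * Real.exp (-(t ^ 2 / 2))) :=
        add_le_add ((measureReal_union_le _ _).trans (add_le_add c1 c2))
          ((measureReal_union_le _ _).trans (add_le_add c3 c4))
    _ = 4 * K * Real.exp (-(t ^ 2 / 2)) := by ring
    _ ≤ _ := mul_le_mul_of_nonneg_right hC2 (Real.exp_pos _).le

/-! ### Independence of rows. -/

section Independence

variable {Ω : Type*} [MeasurableSpace Ω] {μ : Measure Ω}

/-- The joint law is a product measure over `ι × κ`; curried, it is the product over `ι` of the row
laws, themselves products over `κ`. -/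
theorem ProbabilityTheory.iIndepFun.curry {ι κ E : Type*} [Countable ι] [Countable κ]
    [MeasurableSpace E] {X : ι × κ → Ω → E} (hX : ∀ e, Measurable (X e)) (h : iIndepFun X μ) :
    iIndepFun (fun i ω j => X (i, j) ω) μ := by
  have := h.isProbabilityMeasure
  have hpm : ∀ i j, IsProbabilityMeasure (μ.map (X (i, j))) :=
    fun i j => Measure.isProbabilityMeasure_map (hX (i, j)).aemeasurable
  have hrow : ∀ i, iIndepFun (fun j => X (i, j)) μ :=
    fun i => h.precomp (g := fun j => (i, j)) (Prod.mk_right_injective i)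
  rw [iIndepFun_iff_map_fun_eq_infinitePi_map
    (fun i => measurable_pi_lambda _ fun j => hX (i, j))]
  have h1 := (iIndepFun_iff_map_fun_eq_infinitePi_map hX).1 h
  have h2 : (fun ω i j => X (i, j) ω) = (MeasurableEquiv.curry ι κ E) ∘ fun ω e => X e ω := rfl
  rw [h2, ← Measure.map_map (MeasurableEquiv.measurable _) (measurable_pi_lambda _ hX), h1]
  have h3 := Measure.infinitePi_map_curry (fun i j => μ.map (X (i, j)))
  refine h3.trans ?_
  congr 1
  ext1 i
  exact ((iIndepFun_iff_map_fun_eq_infinitePi_map (fun j => hX (i, j))).1 (hrow i)).symm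

end Independence

/-! ### From `ψ₂` bounds to moment generating functions and back. -/

section SubGaussian

variable {Ω : Type*} [MeasurableSpace Ω] {μ : Measure Ω}

theorem integrable_of_lintegral_ofReal_le {f : Ω → ℝ} (hf : Measurable f) (hf0 : ∀ ω, 0 ≤ f ω)
    {C : ℝ} (h : ∫⁻ ω, ENNReal.ofReal (f ω) ∂μ ≤ ENNReal.ofReal C) : Integrable f μ := by
  refine ⟨hf.aestronglyMeasurable, ?_⟩
  rw [hasFiniteIntegral_iff_ofReal (Filter.Eventually.of_forall hf0)]
  exact h.trans_lt ENNReal.ofReal_lt_top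

theorem integral_le_of_lintegral_ofReal_le {f : Ω → ℝ} (hf : Measurable f) (hf0 : ∀ ω, 0 ≤ f ω)
    {C : ℝ} (hC : 0 ≤ C) (h : ∫⁻ ω, ENNReal.ofReal (f ω) ∂μ ≤ ENNReal.ofReal C) :
    ∫ ω, f ω ∂μ ≤ C := by
  rw [integral_eq_lintegral_of_nonneg_ae (Filter.Eventually.of_forall hf0) hf.aestronglyMeasurable]
  exact ENNReal.toReal_le_of_le_ofReal hC h

theorem ProbabilityTheory.HasSubgaussianMGF.mono {X : Ω → ℝ} {c d : NNReal}
    (h : HasSubgaussianMGF X c μ) (hcd : c ≤ d) : HasSubgaussianMGF X d μ :=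
  ⟨h.1, fun t => (h.2 t).trans (Real.exp_le_exp.2 (by
    have : (c : ℝ) ≤ d := hcd
    gcongr))⟩

/-- Linear combinations of independent centred sub-Gaussian variables are sub-Gaussian. -/
theorem hasSubgaussianMGF_sum_mul {n : ℕ} {X : Fin n → Ω → ℝ} (hind : iIndepFun X μ)
    {N : ℝ} (hX : ∀ j, HasSubgaussianMGF (X j) (Real.toNNReal (9 * N ^ 2)) μ)
    {x : EuclideanSpace ℝ (Fin n)} (hx : ‖x‖ ≤ 1) :
    HasSubgaussianMGF (fun ω => ∑ j, X j ω * x j) (Real.toNNReal (9 * N ^ 2)) μ := by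
  have hmul : ∀ j, HasSubgaussianMGF (fun ω => x j * X j ω)
      (Real.toNNReal (x j ^ 2) * Real.toNNReal (9 * N ^ 2)) μ := by
    intro j
    rw [Real.toNNReal_of_nonneg (sq_nonneg (x j))]
    exact (hX j).const_mul (x j)
  have h1 := HasSubgaussianMGF.sum_of_iIndepFun (s := Finset.univ)
    (hind.comp (fun j z => x j * z) (fun j => by fun_prop)) (fun j _ => hmul j)
  refine HasSubgaussianMGF.mono (h1.congr (Filter.Eventually.of_forall fun ω => ?_)) ?_
  · simp [mul_comm]
  · rw [← Finset.sum_mul]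
    refine mul_le_of_le_one_left zero_le ?_
    rw [← Real.toNNReal_sum_of_nonneg fun j _ => sq_nonneg (x j), Real.toNNReal_le_one]
    have h2 := EuclideanSpace.norm_sq_eq x
    simp only [Real.norm_eq_abs, sq_abs] at h2
    rw [← h2]
    exact pow_le_one₀ (norm_nonneg x) hx

variable [IsProbabilityMeasure μ]

/-- The zero mean removes the linear Taylor term, and `|lX| ≤ X²/(2N²) + l²N²/2`. With `b = l²N²`
this bounds the generating function by `1 + 4b exp(b/2) ≤ exp(b/2)(1 + 4b) ≤ exp(9b/2)`, whence the
proxy `9N²`. -/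
theorem hasSubgaussianMGF_of_lintegral_exp_sq_le {X : Ω → ℝ} (hX : Measurable X)
    (hmean : ∫ ω, X ω ∂μ = 0) {N : ℝ} (hN : 0 < N)
    (h : ∫⁻ ω, ENNReal.ofReal (Real.exp (X ω ^ 2 / N ^ 2)) ∂μ ≤ 2) :
    HasSubgaussianMGF X (Real.toNNReal (9 * N ^ 2)) μ := by
  have h' : ∫⁻ ω, ENNReal.ofReal (Real.exp (X ω ^ 2 / N ^ 2)) ∂μ ≤ ENNReal.ofReal 2 := by simpa
  have hm : Measurable fun ω => Real.exp (X ω ^ 2 / N ^ 2) := by fun_prop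
  have hint := integrable_of_lintegral_ofReal_le hm (fun ω => (Real.exp_pos _).le) h'
  have hE := integral_le_of_lintegral_ofReal_le hm (fun ω => (Real.exp_pos _).le) (by norm_num) h'
  have habs : ∀ l ω, |l * X ω| ≤ X ω ^ 2 / N ^ 2 / 2 + l ^ 2 * N ^ 2 / 2 := by
    intro l ω
    have e1 : X ω ^ 2 / N ^ 2 = (|X ω| / N) ^ 2 := by rw [div_pow, sq_abs]
    have e2 : |l * X ω| = (|X ω| / N) * (|l| * N) := by rw [abs_mul]; field_simp
    have e3 : l ^ 2 * N ^ 2 = (|l| * N) ^ 2 := by rw [mul_pow, sq_abs]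
    rw [e1, e2, e3]
    nlinarith [sq_nonneg (|X ω| / N - |l| * N)]
  have hpt : ∀ l ω, Real.exp (l * X ω) ≤ 1 + l * X ω +
      2 * (l ^ 2 * N ^ 2) * Real.exp (l ^ 2 * N ^ 2 / 2) * Real.exp (X ω ^ 2 / N ^ 2) := by
    intro l ω
    have e1 : Real.exp |l * X ω| ≤
        Real.exp (X ω ^ 2 / N ^ 2 / 2) * Real.exp (l ^ 2 * N ^ 2 / 2) := by
      rw [← Real.exp_add]; exact Real.exp_le_exp.2 (habs l ω)
    have e2 : X ω ^ 2 ≤ N ^ 2 * (2 * Real.exp (X ω ^ 2 / N ^ 2 / 2)) := by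
      have := Real.add_one_le_exp (X ω ^ 2 / N ^ 2 / 2)
      calc X ω ^ 2 = N ^ 2 * (2 * (X ω ^ 2 / N ^ 2 / 2)) := by field_simp
        _ ≤ _ := by gcongr; linarith
    have e3 : Real.exp (X ω ^ 2 / N ^ 2) =
        Real.exp (X ω ^ 2 / N ^ 2 / 2) * Real.exp (X ω ^ 2 / N ^ 2 / 2) := by
      rw [← Real.exp_add]; ring_nf
    calc _ ≤ 1 + l * X ω + (l * X ω) ^ 2 * Real.exp |l * X ω| :=
          Real.exp_le_one_add_add_sq_mul_exp_abs _
      _ ≤ 1 + l * X ω + l ^ 2 * (N ^ 2 * (2 * Real.exp (X ω ^ 2 / N ^ 2 / 2))) *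
          (Real.exp (X ω ^ 2 / N ^ 2 / 2) * Real.exp (l ^ 2 * N ^ 2 / 2)) := by
          rw [mul_pow]; gcongr
      _ = _ := by rw [e3]; ring
  have hXint : Integrable X μ := by
    refine (hint.const_mul N).mono' hX.aestronglyMeasurable (Filter.Eventually.of_forall fun ω => ?_)
    have e1 := habs N⁻¹ ω
    have e2 := Real.add_one_le_exp (X ω ^ 2 / N ^ 2)
    have e3 : |N⁻¹ * X ω| = |X ω| / N := by
      rw [abs_mul, abs_of_pos (inv_pos.2 hN)]; field_simp
    have e4 : N⁻¹ ^ 2 * N ^ 2 = 1 := by field_simp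
    have e5 : 0 ≤ X ω ^ 2 / N ^ 2 := by positivity
    rw [e3, e4] at e1
    have e6 : |X ω| / N ≤ Real.exp (X ω ^ 2 / N ^ 2) := by linarith
    rw [div_le_iff₀ hN] at e6
    rw [Real.norm_eq_abs]; linarith
  have hexpint : ∀ l, Integrable (fun ω => Real.exp (l * X ω)) μ := by
    intro l
    refine (hint.const_mul (Real.exp (l ^ 2 * N ^ 2 / 2))).mono'
      (by fun_prop) (Filter.Eventually.of_forall fun ω => ?_)
    rw [Real.norm_eq_abs, Real.abs_exp, ← Real.exp_add]
    have e5 : 0 ≤ X ω ^ 2 / N ^ 2 := by positivity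
    exact Real.exp_le_exp.2 (by linarith [habs l ω, le_abs_self (l * X ω)])
  refine ⟨hexpint, fun l => ?_⟩
  rw [Real.coe_toNNReal _ (by positivity)]
  have hi : Integrable (fun ω => 1 + l * X ω) μ := (integrable_const _).add (hXint.const_mul l)
  calc mgf X μ l = ∫ ω, Real.exp (l * X ω) ∂μ := rfl
    _ ≤ ∫ ω, (1 + l * X ω +
        2 * (l ^ 2 * N ^ 2) * Real.exp (l ^ 2 * N ^ 2 / 2) * Real.exp (X ω ^ 2 / N ^ 2)) ∂μ :=
        integral_mono (hexpint l) (hi.add (hint.const_mul _)) (hpt l)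
    _ = 1 + 2 * (l ^ 2 * N ^ 2) * Real.exp (l ^ 2 * N ^ 2 / 2) *
        ∫ ω, Real.exp (X ω ^ 2 / N ^ 2) ∂μ := by
        rw [integral_add hi (hint.const_mul _), integral_add (integrable_const _)
          (hXint.const_mul l), integral_const_mul, integral_const_mul, hmean]
        simp
    _ ≤ 1 + 2 * (l ^ 2 * N ^ 2) * Real.exp (l ^ 2 * N ^ 2 / 2) * 2 := by gcongr
    _ ≤ Real.exp (l ^ 2 * N ^ 2 / 2) * (4 * (l ^ 2 * N ^ 2) + 1) := by
        have := Real.one_le_exp (show 0 ≤ l ^ 2 * N ^ 2 / 2 by positivity)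
        linarith
    _ ≤ Real.exp (l ^ 2 * N ^ 2 / 2) * Real.exp (4 * (l ^ 2 * N ^ 2)) := by
        gcongr; exact Real.add_one_le_exp _
    _ = _ := by rw [← Real.exp_add]; congr 1; ring

theorem ProbabilityTheory.HasSubgaussianMGF.measure_abs_ge_le {X : Ω → ℝ} {c : NNReal}
    (h : HasSubgaussianMGF X c μ) {t : ℝ} (ht : 0 ≤ t) :
    μ.real {ω | t ≤ |X ω|} ≤ 2 * Real.exp (-t ^ 2 / (2 * c)) := by
  have h1 := h.measure_ge_le ht
  have h2 := h.neg.measure_ge_le ht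
  have : {ω | t ≤ |X ω|} ⊆ {ω | t ≤ X ω} ∪ {ω | t ≤ (-X) ω} := by
    intro ω hω
    rcases le_abs.1 (show t ≤ |X ω| from hω) with h | h
    exacts [Or.inl h, Or.inr h]
  linarith [(measureReal_mono this (μ := μ)).trans (measureReal_union_le _ _)]

/-- If the sum exceeds `t`, one of the three terms is at least `t/3`, so the tail is at most `6
exp(-t²/(162N²))`. The constant `34` works because `7 · 162 = 1134 ≤ 34² = 1156`. -/
theorem lintegral_exp_sq_abs_add_le {u v w : Ω → ℝ} (hum : Measurable u) (hvm : Measurable v)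
    (hwm : Measurable w) {N : ℝ} (hN : 0 < N)
    (hu : HasSubgaussianMGF u (Real.toNNReal (9 * N ^ 2)) μ)
    (hv : HasSubgaussianMGF v (Real.toNNReal (9 * N ^ 2)) μ)
    (hw : HasSubgaussianMGF w (Real.toNNReal (9 * N ^ 2)) μ) :
    ∫⁻ ω, ENNReal.ofReal
      (Real.exp ((|u ω / (34 * N)| + |v ω / (34 * N)| + |w ω / (34 * N)|) ^ 2)) ∂μ ≤ 2 := by
  have h := lintegral_exp_sq_le_two_of_tail (μ := μ) (Z := fun ω => |u ω| + |v ω| + |w ω|)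
    (C := 6) (c := 1 / (162 * N ^ 2)) (a := 1 / (34 * N) ^ 2) (by fun_prop) (by norm_num)
    (by positivity) ?_ ?_
  · convert h using 5 with ω
    rw [abs_div, abs_div, abs_div, abs_of_pos (show 0 < 34 * N by positivity)]
    field_simp
  · rw [div_mul_eq_mul_div, div_le_div_iff₀ (by positivity) (by positivity)]
    nlinarith [sq_nonneg N]
  · intro t ht
    have ht3 : 0 ≤ t / 3 := by positivity
    have hsub : {ω | t < |(|u ω| + |v ω| + |w ω|)|} ⊆
        {ω | t / 3 ≤ |u ω|} ∪ ({ω | t / 3 ≤ |v ω|} ∪ {ω | t / 3 ≤ |w ω|}) := by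
      intro ω hω
      simp only [Set.mem_ofPred_eq, Set.mem_union] at hω ⊢
      rw [abs_of_nonneg (by positivity)] at hω
      by_contra! h
      linarith [h.1, h.2.1, h.2.2]
    have e : Real.exp (-(t / 3) ^ 2 / (2 * (Real.toNNReal (9 * N ^ 2) : ℝ))) =
        Real.exp (-(1 / (162 * N ^ 2)) * t ^ 2) := by
      rw [Real.coe_toNNReal _ (by positivity)]
      congr 1; field_simp; ring
    have h1 := hu.measure_abs_ge_le ht3
    have h2 := hv.measure_abs_ge_le ht3
    have h3 := hw.measure_abs_ge_le ht3
    rw [e] at h1 h2 h3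
    have h4 := (measureReal_mono hsub (μ := μ)).trans (measureReal_union_le _ _)
    have h5 := measureReal_union_le (μ := μ) {ω | t / 3 ≤ |v ω|} {ω | t / 3 ≤ |w ω|}
    linarith

end SubGaussian

/-! ### Lower bounds on `L^p` moments of a variable with unit second moment. -/

/-- Jensen for the power `p / 2`, by integrating the tangent line at `1`. -/
theorem one_le_integral_abs_rpow {Ω : Type*} [MeasurableSpace Ω] {μ : Measure Ω}
    [IsProbabilityMeasure μ] {Z : Ω → ℝ} {p : ℝ} (hp : 2 ≤ p)
    (hZ2 : Integrable (fun ω => Z ω ^ 2) μ) (hZp : Integrable (fun ω => |Z ω| ^ p) μ)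
    (hvar : ∫ ω, Z ω ^ 2 ∂μ = 1) : 1 ≤ ∫ ω, |Z ω| ^ p ∂μ := by
  have hpt : ∀ ω, 1 + p / 2 * (Z ω ^ 2 - 1) ≤ |Z ω| ^ p := by
    intro ω
    have h := one_add_mul_self_le_rpow_one_add (s := Z ω ^ 2 - 1) (p := p / 2)
      (by linarith [sq_nonneg (Z ω)]) (by linarith)
    rw [add_sub_cancel, ← sq_abs, ← Real.rpow_two, ← Real.rpow_mul (abs_nonneg _),
      mul_div_cancel₀ _ two_ne_zero] at h
    simpa using h
  have hi : Integrable (fun ω => 1 + p / 2 * (Z ω ^ 2 - 1)) μ :=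
    (integrable_const _).add ((hZ2.sub (integrable_const _)).const_mul _)
  calc (1 : ℝ) = ∫ ω, (1 + p / 2 * (Z ω ^ 2 - 1)) ∂μ := by
        have h1 : Integrable (fun ω => Z ω ^ 2 - 1) μ := hZ2.sub (integrable_const _)
        rw [integral_add (integrable_const _) (h1.const_mul _), integral_const_mul,
          integral_sub hZ2 (integrable_const _), hvar]
        simp
    _ ≤ _ := integral_mono hi hZp hpt

/-- Pointwise `|z| ^ p ≥ L ^ (p - 2) * (z² - z⁴/L²)`: for `|z| ≤ L` because `p ≤ 2`, and for `|z| ≥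
L` because the right side is nonpositive. The exponential moment gives `E Z⁴ ≤ 4s⁴`, so with `L =
3s²` the integrated bracket is at least `1 - 4/9`. -/
theorem rpow_le_integral_abs_rpow {Ω : Type*} [MeasurableSpace Ω] {μ : Measure Ω}
    [IsProbabilityMeasure μ] {Z : Ω → ℝ} (hZm : Measurable Z) {p s : ℝ} (hp : 1 ≤ p) (hp2 : p ≤ 2)
    (hs : 1 ≤ s) (hZ2 : Integrable (fun ω => Z ω ^ 2) μ)
    (hZp : Integrable (fun ω => |Z ω| ^ p) μ) (hvar : ∫ ω, Z ω ^ 2 ∂μ = 1)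
    (hexp : Integrable (fun ω => Real.exp ((Z ω / s) ^ 2)) μ)
    (hE : ∫ ω, Real.exp ((Z ω / s) ^ 2) ∂μ ≤ 2) :
    (1 / (6 * s ^ 2)) ^ p ≤ ∫ ω, |Z ω| ^ p ∂μ := by
  have hs0 : 0 < s := by linarith
  have h4pt : ∀ ω, Z ω ^ 4 ≤ 2 * s ^ 4 * Real.exp ((Z ω / s) ^ 2) := by
    intro ω
    have h := Real.pow_div_factorial_le_exp ((Z ω / s) ^ 2) (by positivity) 2
    have h1 : Z ω ^ 4 = 2 * s ^ 4 * (((Z ω / s) ^ 2) ^ 2 / (Nat.factorial 2 : ℝ)) := by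
      rw [Nat.factorial_two]; field_simp; norm_num
    rw [h1]; gcongr
  have hZ4 : Integrable (fun ω => Z ω ^ 4) μ := by
    refine (hexp.const_mul (2 * s ^ 4)).mono' (by fun_prop)
      (Filter.Eventually.of_forall fun ω => ?_)
    rw [Real.norm_eq_abs, abs_of_nonneg (by positivity)]
    exact h4pt ω
  have hE4 : ∫ ω, Z ω ^ 4 ∂μ ≤ 4 * s ^ 4 := by
    calc _ ≤ ∫ ω, 2 * s ^ 4 * Real.exp ((Z ω / s) ^ 2) ∂μ :=
          integral_mono hZ4 (hexp.const_mul _) h4pt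
      _ = 2 * s ^ 4 * ∫ ω, Real.exp ((Z ω / s) ^ 2) ∂μ := integral_const_mul _ _
      _ ≤ 2 * s ^ 4 * 2 := by gcongr
      _ = _ := by ring
  set L := 3 * s ^ 2 with hL
  have hs2 : 1 ≤ s ^ 2 := one_le_pow₀ hs
  have hL1 : 1 ≤ L := by linarith
  have hL0 : 0 < L := by linarith
  have hpt : ∀ ω, L ^ (p - 2) * (Z ω ^ 2 - Z ω ^ 4 / L ^ 2) ≤ |Z ω| ^ p := by
    intro ω
    have hLp : 0 < L ^ (p - 2) := by positivity
    rcases eq_or_ne (Z ω) 0 with h0 | h0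
    · rw [h0, abs_zero, Real.zero_rpow (by linarith)]; simp
    have habs : 0 < |Z ω| := abs_pos.2 h0
    rcases le_total |Z ω| L with h | h
    · have h1 : |Z ω| ^ p = |Z ω| ^ (p - 2) * Z ω ^ 2 := by
        rw [← sq_abs, ← Real.rpow_two, ← Real.rpow_add habs]; ring_nf
      have h2 : L ^ (p - 2) ≤ |Z ω| ^ (p - 2) :=
        Real.rpow_le_rpow_of_nonpos habs h (by linarith)
      have h3 : 0 ≤ Z ω ^ 4 / L ^ 2 := by positivity
      calc _ ≤ L ^ (p - 2) * Z ω ^ 2 := by gcongr; linarith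
        _ ≤ |Z ω| ^ (p - 2) * Z ω ^ 2 := by gcongr
        _ = _ := h1.symm
    · have h1 : Z ω ^ 2 ≤ Z ω ^ 4 / L ^ 2 := by
        rw [le_div_iff₀ (by positivity)]
        have : L ^ 2 ≤ Z ω ^ 2 := by rw [← sq_abs (Z ω)]; gcongr
        nlinarith [sq_nonneg (Z ω)]
      have h2 : L ^ (p - 2) * (Z ω ^ 2 - Z ω ^ 4 / L ^ 2) ≤ 0 :=
        mul_nonpos_of_nonneg_of_nonpos hLp.le (by linarith)
      exact h2.trans (by positivity)
  have h1 : L ^ (p - 2) * (1 - 4 * s ^ 4 / L ^ 2) ≤ ∫ ω, |Z ω| ^ p ∂μ := by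
    calc _ ≤ L ^ (p - 2) * (1 - (∫ ω, Z ω ^ 4 ∂μ) / L ^ 2) := by gcongr
      _ = ∫ ω, L ^ (p - 2) * (Z ω ^ 2 - Z ω ^ 4 / L ^ 2) ∂μ := by
          rw [integral_const_mul, integral_sub hZ2 (hZ4.div_const _), hvar, integral_div]
      _ ≤ _ := integral_mono ((hZ2.sub (hZ4.div_const _)).const_mul _) hZp hpt
  refine le_trans ?_ h1
  have h2 : (1 / 2 : ℝ) ≤ 1 - 4 * s ^ 4 / L ^ 2 := by
    have : 4 * s ^ 4 / L ^ 2 = 4 / 9 := by rw [hL]; field_simp; norm_num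
    rw [this]; norm_num
  have h3 : (1 / (6 * s ^ 2) : ℝ) ^ p = (1 / L) ^ p * (1 / 2) ^ p := by
    rw [← Real.mul_rpow (by positivity) (by positivity)]
    congr 1; rw [hL]; field_simp; norm_num
  rw [h3]
  have h4 : (1 / L) ^ p ≤ L ^ (p - 2) := by
    rw [one_div, Real.inv_rpow hL0.le, ← Real.rpow_neg hL0.le]
    exact Real.rpow_le_rpow_of_exponent_le hL1 (by linarith)
  have h5 : (1 / 2 : ℝ) ^ p ≤ 1 / 2 := by
    calc _ ≤ (1 / 2 : ℝ) ^ (1 : ℝ) :=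
          Real.rpow_le_rpow_of_exponent_ge (by norm_num) (by norm_num) hp
      _ = _ := Real.rpow_one _
  calc _ ≤ L ^ (p - 2) * (1 / 2) := by gcongr
    _ ≤ _ := by gcongr

/-! ### Norm formula, `K ≥ 1`, and basic properties of the matrix. -/

theorem ellNorm_ofReal {m : ℕ} {p : ℝ} (hp : 1 ≤ p) (z : Fin m → ℝ) :
    ellNorm (ENNReal.ofReal p) z = (∑ i, |z i| ^ p) ^ (1 / p) := by
  have h : (ENNReal.ofReal p).toReal = p := ENNReal.toReal_ofReal (by linarith)
  rw [ellNorm, PiLp.norm_eq_sum (by rw [h]; linarith), h]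
  simp

/-- For admissible `t`, `2 ≥ E exp(X²/t²) ≥ 1 + 1/t²`. Hence `K ≥ 1`, so lower powers of `K` may be
replaced by higher ones. -/
theorem one_le_orliczNorm_two {Ω : Type*} [MeasurableSpace Ω] {μ : Measure Ω}
    [IsProbabilityMeasure μ] {X : Ω → ℝ} (hX : Measurable X)
    (hX2 : ∫ ω, X ω ^ 2 ∂μ = 1) : 1 ≤ orliczNorm 2 X μ := by
  refine le_sInf ?_
  rintro _ ⟨t, ⟨ht, h⟩, rfl⟩
  simp only [Real.rpow_two, sq_abs] at h
  have h' : ∫⁻ ω, ENNReal.ofReal (Real.exp (X ω ^ 2 / t ^ 2)) ∂μ ≤ ENNReal.ofReal 2 := by simpa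
  have hm : Measurable fun ω => Real.exp (X ω ^ 2 / t ^ 2) := by fun_prop
  have hint := integrable_of_lintegral_ofReal_le hm (fun ω => (Real.exp_pos _).le) h'
  have hE := integral_le_of_lintegral_ofReal_le hm (fun ω => (Real.exp_pos _).le) (by norm_num) h'
  have hX2i : Integrable (fun ω => X ω ^ 2) μ := by
    by_contra h
    rw [integral_undef h] at hX2
    exact zero_ne_one hX2
  have h1 : ∫ ω, (X ω ^ 2 / t ^ 2 + 1) ∂μ ≤ ∫ ω, Real.exp (X ω ^ 2 / t ^ 2) ∂μ :=
    integral_mono ((hX2i.div_const _).add (integrable_const _)) hint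
      fun ω => Real.add_one_le_exp _
  rw [integral_add (hX2i.div_const _) (integrable_const _), integral_div, hX2] at h1
  simp only [integral_const, probReal_univ, smul_eq_mul, mul_one] at h1
  have h2 : 1 / t ^ 2 ≤ 1 := by linarith
  rw [div_le_one (by positivity)] at h2
  have h3 : 1 ≤ t := by nlinarith
  simpa using h3

namespace IsIIDSubGaussianMatrix

variable {Ω : Type*} [MeasurableSpace Ω] {μ : Measure Ω} {m n : ℕ}
  {A : Ω → Matrix (Fin m) (Fin n) ℝ}

theorem iIndepFun_row (hA : IsIIDSubGaussianMatrix A μ) :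
    iIndepFun (fun i ω j => A ω i j) μ :=
  hA.indep.curry fun e => hA.measurable_entry e.1 e.2

theorem iIndepFun_entry (hA : IsIIDSubGaussianMatrix A μ) (i : Fin m) :
    iIndepFun (fun j ω => A ω i j) μ :=
  hA.indep.precomp (g := fun j => (i, j)) (Prod.mk_right_injective i)

theorem measurable_mulVec (hA : IsIIDSubGaussianMatrix A μ) (x : Fin n → ℝ) (i : Fin m) :
    Measurable fun ω => (A ω *ᵥ x) i := by
  have := hA.measurable_entry
  simp only [Matrix.mulVec, dotProduct]
  fun_prop

theorem integral_sq_entry (hA : IsIIDSubGaussianMatrix A μ) (i : Fin m) (j : Fin n) :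
    ∫ ω, A ω i j ^ 2 ∂μ = 1 := by
  rw [← hA.unit_variance i j, variance_of_integral_eq_zero
    (hA.measurable_entry i j).aemeasurable (hA.mean_zero i j)]

theorem identDistrib_row (hA : IsIIDSubGaussianMatrix A μ) (i k : Fin m) :
    IdentDistrib (fun ω j => A ω i j) (fun ω j => A ω k j) μ μ :=
  IdentDistrib.pi (fun j => hA.identDistrib i j k j) (hA.iIndepFun_entry i) (hA.iIndepFun_entry k)

variable [IsProbabilityMeasure μ]

theorem hasSubgaussianMGF_entry (hA : IsIIDSubGaussianMatrix A μ) [NeZero m] [NeZero n] {N : ℝ}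
    (hN : 0 < N) (h : orliczNorm 2 (fun ω => A ω 0 0) μ < ENNReal.ofReal N) (i : Fin m)
    (j : Fin n) : HasSubgaussianMGF (fun ω => A ω i j) (Real.toNNReal (9 * N ^ 2)) μ := by
  refine hasSubgaussianMGF_of_lintegral_exp_sq_le (hA.measurable_entry i j) (hA.mean_zero i j) hN ?_
  have h1 := (hA.identDistrib i j 0 0).comp
    (u := fun z => ENNReal.ofReal (Real.exp (z ^ 2 / N ^ 2))) (by fun_prop)
  exact h1.lintegral_eq.trans_le (lintegral_exp_sq_le_two_of_orliczNorm_lt h)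

theorem hasSubgaussianMGF_mulVec (hA : IsIIDSubGaussianMatrix A μ) [NeZero m] [NeZero n] {N : ℝ}
    (hN : 0 < N) (h : orliczNorm 2 (fun ω => A ω 0 0) μ < ENNReal.ofReal N) (i : Fin m)
    {x : EuclideanSpace ℝ (Fin n)} (hx : ‖x‖ ≤ 1) :
    HasSubgaussianMGF (fun ω => (A ω *ᵥ x.ofLp) i) (Real.toNNReal (9 * N ^ 2)) μ :=
  hasSubgaussianMGF_sum_mul (hA.iIndepFun_entry i) (fun j => hA.hasSubgaussianMGF_entry hN h i j) hx

theorem integral_sq_mulVec (hA : IsIIDSubGaussianMatrix A μ) [NeZero m] [NeZero n] {N : ℝ}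
    (hN : 0 < N) (h : orliczNorm 2 (fun ω => A ω 0 0) μ < ENNReal.ofReal N) (i : Fin m)
    (x : EuclideanSpace ℝ (Fin n)) : ∫ ω, (A ω *ᵥ x.ofLp) i ^ 2 ∂μ = ‖x‖ ^ 2 := by
  have hL : ∀ j, MemLp (fun ω => A ω i j) 2 μ := fun j =>
    (hA.hasSubgaussianMGF_entry hN h i j).memLp 2
  have hmean : ∫ ω, (A ω *ᵥ x.ofLp) i ∂μ = 0 := by
    simp only [Matrix.mulVec, dotProduct]
    rw [integral_finsetSum _ fun j _ => ((hL j).integrable one_le_two).mul_const _]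
    simp [integral_mul_const, hA.mean_zero]
  have h1 := variance_of_integral_eq_zero (hA.measurable_mulVec x.ofLp i).aemeasurable hmean
  rw [← h1]
  have h2 := IndepFun.variance_sum (μ := μ) (X := fun j ω => A ω i j * x j) (s := Finset.univ)
    (fun j _ => (hL j).mul_const (x j)) (fun j _ k _ hjk =>
      ((hA.iIndepFun_entry i).indepFun hjk).comp (φ := fun z => z * x j) (ψ := fun z => z * x k)
        (by fun_prop) (by fun_prop))
  have h3 : (fun ω => (A ω *ᵥ x.ofLp) i) = ∑ j, fun ω => A ω i j * x j := by
    ext ω; simp [Matrix.mulVec, dotProduct]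
  rw [h3, h2, EuclideanSpace.norm_sq_eq]
  refine Finset.sum_congr rfl fun j _ => ?_
  rw [variance_mul_const, hA.unit_variance]
  simp

end IsIIDSubGaussianMatrix

/-! ### The radius of the dual ball and the lower bound `θ`. -/

/-- Test vectors: a coordinate vector if `p ≥ 2`; if `p ≤ 2`, the constant vector with entries `m ^
(-1/q)`, of `ℓ_q` norm `1` and Euclidean norm `m ^ (1/2 - 1/q) = m ^ (1/p - 1/2)`. -/
theorem ofReal_rpow_le_rad_ellBall {p : ℝ} (hp : 1 ≤ p) {q : ℝ≥0∞}
    (hpq : ENNReal.HolderConjugate (ENNReal.ofReal p) q) (m : ℕ) [NeZero m] :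
    ENNReal.ofReal ((m : ℝ) ^ (1 / p - 1 / max p 2)) ≤ rad (ellBall m q) := by
  have hm1 : 1 ≤ (m : ℝ) := by exact_mod_cast Nat.pos_of_ne_zero (NeZero.ne m)
  have hm : 0 < (m : ℝ) := by linarith
  have hp0 : 0 < p := by linarith
  have hinv := ENNReal.HolderTriple.inv_add_inv_eq_inv (ENNReal.ofReal p) q 1
  have hq0 : q ≠ 0 := by
    rintro rfl
    simp at hinv
  have hqr : q ≠ ∞ → 0 < q.toReal ∧ 1 / p + 1 / q.toReal = 1 := by
    intro hq
    have h := ENNReal.toReal_pos hq0 hq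
    refine ⟨h, ?_⟩
    have h1 := congrArg ENNReal.toReal hinv
    rw [ENNReal.toReal_add (by simp; linarith) (by simpa using hq0)] at h1
    simpa [ENNReal.toReal_inv, ENNReal.toReal_ofReal hp0.le] using h1
  have key : ∀ z : EuclideanSpace ℝ (Fin m), ellNorm q z.ofLp ≤ 1 →
      ENNReal.ofReal ‖z‖ ≤ rad (ellBall m q) := fun z hz =>
    le_iSup₂_of_le z hz le_rfl
  rcases le_total 2 p with h2 | h2
  · rw [max_eq_left h2, sub_self, Real.rpow_zero]
    have h := key (EuclideanSpace.single 0 1) ?_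
    · simpa using h
    · rcases eq_or_ne q ∞ with hq | hq
      · subst hq
        rw [ellNorm, PiLp.norm_eq_ciSup]
        refine ciSup_le fun i => ?_
        by_cases hi : i = 0 <;> simp [hi]
      · obtain ⟨hq1, -⟩ := hqr hq
        rw [ellNorm, PiLp.norm_eq_sum hq1, Finset.sum_eq_single 0]
        · simp
        · intro i _ hi
          simp [hi, hq1.ne']
        · simp
  · rw [max_eq_right h2]
    have h := key (WithLp.toLp 2 fun _ => (m : ℝ) ^ (-(1 - 1 / p))) ?_
    · convert h using 2
      rw [EuclideanSpace.norm_eq]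
      simp only [Real.norm_eq_abs, sq_abs, Finset.sum_const, Finset.card_univ, Fintype.card_fin,
        nsmul_eq_mul]
      rw [Real.sqrt_eq_rpow, Real.mul_rpow hm.le (by positivity), ← Real.rpow_natCast,
        ← Real.rpow_mul hm.le, ← Real.rpow_mul hm.le, ← Real.rpow_add hm]
      congr 1; push_cast; ring
    · have hr : 0 ≤ 1 - 1 / p := by
        rw [sub_nonneg, div_le_one hp0]; exact hp
      rcases eq_or_ne q ∞ with hq | hq
      · subst hq
        rw [ellNorm, PiLp.norm_eq_ciSup]
        refine ciSup_le fun i => ?_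
        simp only [Real.norm_eq_abs]
        rw [abs_of_pos (by positivity)]
        exact Real.rpow_le_one_of_one_le_of_nonpos hm1 (by linarith)
      · obtain ⟨hq1, hq2⟩ := hqr hq
        rw [ellNorm, PiLp.norm_eq_sum hq1]
        simp only [Real.norm_eq_abs, Finset.sum_const, Finset.card_univ, Fintype.card_fin,
          nsmul_eq_mul]
        rw [abs_of_pos (by positivity), ← Real.rpow_mul hm.le]
        have : -(1 - 1 / p) * q.toReal = -1 := by
          rw [show 1 - 1 / p = 1 / q.toReal by linarith]; field_simp
        rw [this, Real.rpow_neg_one, mul_inv_cancel₀ hm.ne', Real.one_rpow]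

/-- A lower bound for normalised `L^p` norms that is polynomial in the sub-Gaussian norm. -/
theorem exists_le_integral_abs_rpow_div {p s : ℝ} (hp : 1 ≤ p) (hs : 1 ≤ s) :
    ∃ θ : ℝ, 0 < θ ∧ θ ≤ 1 ∧ s * θ ^ (-(2 * p - 1)) ≤ 6 ^ (2 * p - 1) * s ^ (4 * p + 4) ∧
      ∀ {Ω : Type*} [MeasurableSpace Ω] (μ : Measure Ω) [IsProbabilityMeasure μ] (Z : Ω → ℝ),
        Measurable Z → Integrable (fun ω => Z ω ^ 2) μ → Integrable (fun ω => |Z ω| ^ p) μ →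
        ∫ ω, Z ω ^ 2 ∂μ = 1 → Integrable (fun ω => Real.exp ((Z ω / s) ^ 2)) μ →
        ∫ ω, Real.exp ((Z ω / s) ^ 2) ∂μ ≤ 2 → θ ≤ (∫ ω, |Z ω| ^ p ∂μ) ^ (1 / p) / s := by
  have hs0 : 0 < s := by linarith
  have h6 : (1 : ℝ) ≤ 6 ^ (2 * p - 1) := Real.one_le_rpow (by norm_num) (by linarith)
  rcases le_total 2 p with h2 | h2
  · refine ⟨s⁻¹, by positivity, inv_le_one_of_one_le₀ hs, ?_, ?_⟩
    · rw [Real.inv_rpow hs0.le, Real.rpow_neg hs0.le, inv_inv]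
      calc s * s ^ (2 * p - 1) = s ^ (2 * p) := by
            rw [← Real.rpow_one_add' hs0.le (by linarith)]; ring_nf
        _ ≤ s ^ (4 * p + 4) := Real.rpow_le_rpow_of_exponent_le hs (by linarith)
        _ ≤ _ := le_mul_of_one_le_left (by positivity) h6
    · intro Ω _ μ _ Z _ hZ2 hZp hvar _ _
      have h := one_le_integral_abs_rpow h2 hZ2 hZp hvar
      rw [inv_eq_one_div]
      gcongr
      exact Real.one_le_rpow h (by positivity)
  · have hs3 : 1 ≤ s ^ 3 := one_le_pow₀ hs
    -- The moment bound `1 / (6 * s ^ 2)` divided by `s`. The resulting power `s ^ (6 * p - 2)` is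
    -- below `s ^ (4 * p + 4)` because `p ≤ 2`.
    refine ⟨(6 * s ^ 3)⁻¹, by positivity, inv_le_one_of_one_le₀ (by linarith), ?_, ?_⟩
    · rw [Real.inv_rpow (by positivity), Real.rpow_neg (by positivity), inv_inv,
        Real.mul_rpow (by norm_num) (by positivity), ← Real.rpow_natCast, ← Real.rpow_mul hs0.le]
      calc s * (6 ^ (2 * p - 1) * s ^ (((3 : ℕ) : ℝ) * (2 * p - 1))) =
          6 ^ (2 * p - 1) * (s * s ^ (((3 : ℕ) : ℝ) * (2 * p - 1))) := by ring
        _ = 6 ^ (2 * p - 1) * s ^ (6 * p - 2) := by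
            rw [← Real.rpow_one_add' hs0.le (by push_cast; linarith)]
            congr 2; push_cast; ring
        _ ≤ _ := by
            gcongr
            linarith
    · intro Ω _ μ _ Z hZm hZ2 hZp hvar hexp hE
      have h := rpow_le_integral_abs_rpow hZm hp h2 hs hZ2 hZp hvar hexp hE
      have h' := Real.rpow_le_rpow (by positivity) h (show 0 ≤ 1 / p by positivity)
      rw [← Real.rpow_mul (by positivity), mul_one_div_cancel (by linarith), Real.rpow_one] at h'
      calc (6 * s ^ 3)⁻¹ = 1 / (6 * s ^ 2) / s := by field_simp
        _ ≤ _ := by gcongr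

/-! ### The process `R` on the unit sphere. -/

section UnitSphere

variable {Ω : Type*} [MeasurableSpace Ω] {μ : Measure Ω} {m n : ℕ}
  {A : Ω → Matrix (Fin m) (Fin n) ℝ} {p : ℝ}

theorem processR_smul [NeZero m] (hp : 1 ≤ p) {c : ℝ} (hc : 0 ≤ c)
    (x : EuclideanSpace ℝ (Fin n)) (ω : Ω) :
    processR p A μ (c • x) ω = c * processR p A μ x ω := by
  have hp0 : p ≠ 0 := by linarith
  have hcp : (c ^ p) ^ (1 / p) = c := by
    rw [← Real.rpow_mul hc, mul_one_div_cancel hp0, Real.rpow_one]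
  have h1 : ∀ ω i, |(A ω *ᵥ (c • x).ofLp) i| ^ p = c ^ p * |(A ω *ᵥ x.ofLp) i| ^ p := by
    intro ω i
    rw [WithLp.ofLp_smul, Matrix.mulVec_smul, Pi.smul_apply, smul_eq_mul, abs_mul,
      abs_of_nonneg hc, Real.mul_rpow hc (abs_nonneg _)]
  simp only [processR, rowNorm, ellNorm_ofReal hp, h1, ← Finset.mul_sum, integral_const_mul]
  rw [Real.mul_rpow (by positivity) (Finset.sum_nonneg fun i _ => by positivity),
    Real.mul_rpow (by positivity) (integral_nonneg fun ω => by positivity), hcp]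
  ring

theorem measurable_ellNorm_mulVec (hp : 1 ≤ p) (hA : IsIIDSubGaussianMatrix A μ)
    (x : EuclideanSpace ℝ (Fin n)) :
    Measurable fun ω => ellNorm (ENNReal.ofReal p) (A ω *ᵥ x.ofLp) := by
  have := hA.measurable_mulVec x.ofLp
  simp only [ellNorm_ofReal hp]
  fun_prop

/-- Tail bounds for the process `R` on the unit sphere. -/
theorem exists_measure_processR_le (p : ℝ) (hp : 1 ≤ p) :
    ∃ C : ℝ, 1 ≤ C ∧ ∀ (m n : ℕ) [NeZero m] [NeZero n] (Ω : Type*) [MeasurableSpace Ω]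
      (μ : Measure Ω) [IsProbabilityMeasure μ] (A : Ω → Matrix (Fin m) (Fin n) ℝ),
      IsIIDSubGaussianMatrix A μ → ∀ N : ℝ, 1 ≤ N →
      orliczNorm 2 (fun ω => A ω 0 0) μ < ENNReal.ofReal N →
      ∀ x y : EuclideanSpace ℝ (Fin n), ‖x‖ = 1 → ‖y‖ = 1 → ∀ t : ℝ, 1 ≤ t →
      μ.real {ω | C * (m : ℝ) ^ (1 / p - 1 / max p 2) * N ^ (4 * p + 4) * t <
          |processR p A μ x ω| ∨
        C * ‖x - y‖ * (m : ℝ) ^ (1 / p - 1 / max p 2) * N ^ (4 * p + 4) * t <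
          |processR p A μ x ω - processR p A μ y ω|} ≤ C * Real.exp (-(t ^ 2 / 2)) := by
  obtain ⟨C, hC, hmain⟩ := exists_measure_lp_increment_le p hp
  set D : ℝ := 6 ^ (2 * p - 1) * 34 ^ (4 * p + 4) with hD
  have hD1 : 1 ≤ D := by
    have h1 : (1 : ℝ) ≤ 6 ^ (2 * p - 1) := Real.one_le_rpow (by norm_num) (by linarith)
    have h2 : (1 : ℝ) ≤ 34 ^ (4 * p + 4) := Real.one_le_rpow (by norm_num) (by linarith)
    nlinarith
  refine ⟨C * D, by nlinarith, ?_⟩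
  intro m n _ _ Ω _ μ _ A hA N hN hKN x y hx hy t ht
  have hN0 : 0 < N := by linarith
  have hp0 : 0 < p := by linarith
  -- The scale at which the sum of the three absolute coordinates has exponential square moment at
  -- most `2`.
  set s := 34 * N with hs
  have hs1 : 1 ≤ s := by linarith
  have hs0 : 0 < s := by linarith
  obtain ⟨θ, hθ0, hθ1, hθs, hθ⟩ := exists_le_integral_abs_rpow_div hp hs1
  set δ := ‖x - y‖ with hδ
  have hδ0 : 0 ≤ δ := norm_nonneg _
  -- For `x = y` this is the zero vector, so only `‖e‖ ≤ 1` is available, which is enough.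
  set e : EuclideanSpace ℝ (Fin n) := δ⁻¹ • (x - y) with he
  have he1 : ‖e‖ ≤ 1 := by
    rw [he, norm_smul, norm_inv, hδ, norm_norm]
    exact inv_mul_le_one
  have hδe : x - y = δ • e := by
    rcases hδ0.eq_or_lt with h0 | h0
    · rw [← h0, zero_smul]; exact norm_eq_zero.1 h0.symm
    · rw [he, smul_smul, mul_inv_cancel₀ h0.ne', one_smul]
  have hsub := fun i (z : EuclideanSpace ℝ (Fin n)) (hz : ‖z‖ ≤ 1) =>
    hA.hasSubgaussianMGF_mulVec hN0 hKN i hz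
  have hmeas := fun (z : EuclideanSpace ℝ (Fin n)) i => hA.measurable_mulVec z.ofLp i
  have hlin : ∀ i, ∫⁻ ω, ENNReal.ofReal (Real.exp ((|(A ω *ᵥ x.ofLp) i / s| +
      |(A ω *ᵥ y.ofLp) i / s| + |(A ω *ᵥ e.ofLp) i / s|) ^ 2)) ∂μ ≤ ENNReal.ofReal 2 := by
    intro i
    rw [ENNReal.ofReal_ofNat]
    exact lintegral_exp_sq_abs_add_le (hmeas x i) (hmeas y i) (hmeas e i) hN0
      (hsub i x hx.le) (hsub i y hy.le) (hsub i e he1)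
  have hlin_m : ∀ i, Measurable fun ω => Real.exp ((|(A ω *ᵥ x.ofLp) i / s| +
      |(A ω *ᵥ y.ofLp) i / s| + |(A ω *ᵥ e.ofLp) i / s|) ^ 2) := by
    intro i
    have := hmeas x i; have := hmeas y i; have := hmeas e i
    fun_prop
  have hint := fun i => integrable_of_lintegral_ofReal_le (hlin_m i)
    (fun ω => (Real.exp_pos _).le) (hlin i)
  have hE := fun i => integral_le_of_lintegral_ofReal_le (hlin_m i)
    (fun ω => (Real.exp_pos _).le) zero_le_two (hlin i)
  have hrow : ∀ z : EuclideanSpace ℝ (Fin n), ‖z‖ = 1 →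
      (∀ ω, |(A ω *ᵥ z.ofLp) 0 / s| ≤ |(A ω *ᵥ x.ofLp) 0 / s| +
        |(A ω *ᵥ y.ofLp) 0 / s| + |(A ω *ᵥ e.ofLp) 0 / s|) → θ ≤ rowNorm p A μ z / s := by
    intro z hz hle
    have hexp_le : ∀ ω, Real.exp (((A ω *ᵥ z.ofLp) 0 / s) ^ 2) ≤
        Real.exp ((|(A ω *ᵥ x.ofLp) 0 / s| + |(A ω *ᵥ y.ofLp) 0 / s| +
          |(A ω *ᵥ e.ofLp) 0 / s|) ^ 2) := by
      intro ω
      apply Real.exp_le_exp.2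
      rw [← sq_abs]
      exact pow_le_pow_left₀ (abs_nonneg _) (hle ω) 2
    have hzm := hmeas z 0
    have hexp_int : Integrable (fun ω => Real.exp (((A ω *ᵥ z.ofLp) 0 / s) ^ 2)) μ := by
      refine (hint 0).mono' ((hzm.div_const s).pow_const 2).exp.aestronglyMeasurable (Filter.Eventually.of_forall fun ω => ?_)
      rw [Real.norm_eq_abs, Real.abs_exp]
      exact hexp_le ω
    have hzL : ∀ r : NNReal, MemLp (fun ω => (A ω *ᵥ z.ofLp) 0) r μ :=
      fun r => (hsub 0 z hz.le).memLp r
    refine hθ μ (fun ω => (A ω *ᵥ z.ofLp) 0) hzm (hzL 2).integrable_sq ?_ ?_ hexp_int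
      ((integral_mono hexp_int (hint 0) hexp_le).trans (hE 0))
    · have h := (hzL (Real.toNNReal p)).integrable_norm_rpow (by simpa using hp0) (by simp)
      simpa [Real.coe_toNNReal _ hp0.le] using h
    · rw [hA.integral_sq_mulVec hN0 hKN 0 z, hz, one_pow]
  have hmom : ∀ (z : EuclideanSpace ℝ (Fin n)) i,
      ∫ ω, |(A ω *ᵥ z.ofLp) i / s| ^ p ∂μ = (rowNorm p A μ z / s) ^ p := by
    intro z i
    have h1 := ((hA.identDistrib_row i 0).comp
      (u := fun a => |(∑ j, a j * z j) / s| ^ p) (by fun_prop)).integral_eq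
    have h2 : ∫ ω, |(A ω *ᵥ z.ofLp) i / s| ^ p ∂μ = ∫ ω, |(A ω *ᵥ z.ofLp) 0 / s| ^ p ∂μ := h1
    have h3 : 0 ≤ ∫ ω, |(A ω *ᵥ z.ofLp) 0| ^ p ∂μ := integral_nonneg fun ω => by positivity
    have h4 : ∀ ω, |(A ω *ᵥ z.ofLp) 0 / s| ^ p = |(A ω *ᵥ z.ofLp) 0| ^ p / s ^ p := fun ω => by
      rw [abs_div, abs_of_pos hs0, Real.div_rpow (abs_nonneg _) hs0.le]
    rw [h2, rowNorm, Real.div_rpow (by positivity) hs0.le, ← Real.rpow_mul h3,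
      one_div_mul_cancel hp0.ne', Real.rpow_one]
    simp only [h4, integral_div]
  have hind : iIndepFun (fun i ω => ((A ω *ᵥ x.ofLp) i / s, (A ω *ᵥ y.ofLp) i / s,
      (A ω *ᵥ e.ofLp) i / s)) μ :=
    hA.iIndepFun_row.comp (fun _ a => ((∑ j, a j * x j) / s, (∑ j, a j * y j) / s,
      (∑ j, a j * e j) / s)) (fun _ => by fun_prop)
  have hxy : ∀ i ω, (A ω *ᵥ x.ofLp) i / s - (A ω *ᵥ y.ofLp) i / s =
      δ * ((A ω *ᵥ e.ofLp) i / s) := by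
    intro i ω
    have h := congrFun (congrArg (fun z : EuclideanSpace ℝ (Fin n) => A ω *ᵥ z.ofLp) hδe) i
    simp only [WithLp.ofLp_sub, WithLp.ofLp_smul, Matrix.mulVec_sub, Matrix.mulVec_smul,
      Pi.sub_apply, Pi.smul_apply, smul_eq_mul] at h
    rw [← sub_div, h, mul_div_assoc]
  have hfin := hmain μ (fun i ω => (A ω *ᵥ x.ofLp) i / s) (fun i ω => (A ω *ᵥ y.ofLp) i / s)
    (fun i ω => (A ω *ᵥ e.ofLp) i / s) δ (rowNorm p A μ x / s) (rowNorm p A μ y / s) θ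
    (fun i => (hmeas x i).div_const s) (fun i => (hmeas y i).div_const s)
    (fun i => (hmeas e i).div_const s) hδ0 hxy hind hint hE hθ0 hθ1
    (hrow x hx fun ω => by
      linarith [abs_nonneg ((A ω *ᵥ y.ofLp) 0 / s), abs_nonneg ((A ω *ᵥ e.ofLp) 0 / s)])
    (hrow y hy fun ω => by
      linarith [abs_nonneg ((A ω *ᵥ x.ofLp) 0 / s), abs_nonneg ((A ω *ᵥ e.ofLp) 0 / s)])
    (hmom x) (hmom y) t ht
  have hscale : ∀ (z : EuclideanSpace ℝ (Fin n)) ω,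
      (∑ i, |(A ω *ᵥ z.ofLp) i / s| ^ p) ^ (1 / p) =
        ellNorm (ENNReal.ofReal p) (A ω *ᵥ z.ofLp) / s := by
    intro z ω
    have h4 : ∀ i, |(A ω *ᵥ z.ofLp) i / s| ^ p = |(A ω *ᵥ z.ofLp) i| ^ p / s ^ p := fun i => by
      rw [abs_div, abs_of_pos hs0, Real.div_rpow (abs_nonneg _) hs0.le]
    simp only [h4, ← Finset.sum_div, ellNorm_ofReal hp]
    rw [Real.div_rpow (Finset.sum_nonneg fun i _ => by positivity) (by positivity),
      ← Real.rpow_mul hs0.le, mul_one_div_cancel hp0.ne', Real.rpow_one]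
  simp only [hscale] at hfin
  have hsD : s * θ ^ (-(2 * p - 1)) ≤ D * N ^ (4 * p + 4) := by
    refine hθs.trans_eq ?_
    rw [hs, Real.mul_rpow (by norm_num) hN0.le, hD]; ring
  set ρ := (m : ℝ) ^ (1 / p - 1 / max p 2) with hρ
  have hρ0 : 0 ≤ ρ := by positivity
  have ht0 : 0 ≤ t := by linarith
  have hC0 : 0 ≤ C := by linarith
  refine (measureReal_mono ?_).trans (hfin.trans ?_)
  · rintro ω (h | h)
    · left
      have e1 : ellNorm (ENNReal.ofReal p) (A ω *ᵥ x.ofLp) / s -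
          (m : ℝ) ^ (1 / p) * (rowNorm p A μ x / s) = processR p A μ x ω / s := by
        rw [processR]; ring
      rw [e1, abs_div, abs_of_pos hs0, lt_div_iff₀ hs0]
      refine lt_of_le_of_lt ?_ h
      calc C * ρ * θ ^ (-(2 * p - 1)) * t * s = C * ρ * (s * θ ^ (-(2 * p - 1))) * t := by ring
        _ ≤ C * ρ * (D * N ^ (4 * p + 4)) * t := by gcongr
        _ = _ := by ring
    · right
      have e1 : ellNorm (ENNReal.ofReal p) (A ω *ᵥ x.ofLp) / s -
          ellNorm (ENNReal.ofReal p) (A ω *ᵥ y.ofLp) / s -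
          ((m : ℝ) ^ (1 / p) * (rowNorm p A μ x / s) - (m : ℝ) ^ (1 / p) * (rowNorm p A μ y / s)) =
          (processR p A μ x ω - processR p A μ y ω) / s := by
        rw [processR, processR]; ring
      rw [e1, abs_div, abs_of_pos hs0, lt_div_iff₀ hs0]
      refine lt_of_le_of_lt ?_ h
      calc C * δ * ρ * θ ^ (-(2 * p - 1)) * t * s =
          C * δ * ρ * (s * θ ^ (-(2 * p - 1))) * t := by ring
        _ ≤ C * δ * ρ * (D * N ^ (4 * p + 4)) * t := by gcongr
        _ = _ := by ring
  · gcongr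
    nlinarith

end UnitSphere

/-! ### From the sphere to arbitrary increments. -/

theorem exists_norm_eq_one_smul_eq {n : ℕ} [NeZero n] (x : EuclideanSpace ℝ (Fin n)) :
    ∃ e : EuclideanSpace ℝ (Fin n), ‖e‖ = 1 ∧ x = ‖x‖ • e := by
  rcases eq_or_ne x 0 with rfl | hx
  · exact ⟨EuclideanSpace.single 0 1, by simp, by simp⟩
  · have h : ‖x‖ ≠ 0 := norm_ne_zero_iff.2 hx
    refine ⟨‖x‖⁻¹ • x, ?_, ?_⟩
    · rw [norm_smul, norm_inv, norm_norm, inv_mul_cancel₀ h]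
    · rw [smul_smul, mul_inv_cancel₀ h, one_smul]

section Increments

variable {Ω : Type*} [MeasurableSpace Ω] {μ : Measure Ω} [IsProbabilityMeasure μ] {m n : ℕ}
  {A : Ω → Matrix (Fin m) (Fin n) ℝ} {p : ℝ}

theorem integrable_ellNorm_mulVec [NeZero m] [NeZero n] (hp : 1 ≤ p)
    (hA : IsIIDSubGaussianMatrix A μ) {N : ℝ} (hN : 0 < N)
    (h : orliczNorm 2 (fun ω => A ω 0 0) μ < ENNReal.ofReal N) (x : EuclideanSpace ℝ (Fin n)) :
    Integrable (fun ω => ellNorm (ENNReal.ofReal p) (A ω *ᵥ x.ofLp)) μ := by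
  have : Fact (1 ≤ ENNReal.ofReal p) := ⟨by simpa using hp⟩
  have hb : ∀ i, Integrable (fun ω => (A ω *ᵥ x.ofLp) i) μ := by
    intro i
    simp only [Matrix.mulVec, dotProduct]
    exact integrable_finsetSum _ fun j _ =>
      (hA.hasSubgaussianMGF_entry hN h i j).integrable.mul_const _
  refine (integrable_finsetSum Finset.univ fun i _ => (hb i).norm).mono'
    (measurable_ellNorm_mulVec hp hA x).aestronglyMeasurable
    (Filter.Eventually.of_forall fun ω => ?_)
  have h1 : WithLp.toLp (ENNReal.ofReal p) (A ω *ᵥ x.ofLp) =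
      ∑ i, PiLp.single (ENNReal.ofReal p) i ((A ω *ᵥ x.ofLp) i) := by
    ext k
    simp [Finset.sum_apply, Pi.single_apply]
  rw [ellNorm, norm_norm, h1]
  refine (norm_sum_le _ _).trans (le_of_eq (Finset.sum_congr rfl fun i _ => ?_))
  simp

/-- Sub-Gaussian increments of the process `R`. -/
theorem exists_orliczNorm_processR_sub_le (p : ℝ) (hp : 1 ≤ p) :
    ∃ C : ℝ, 0 < C ∧ ∀ (m n : ℕ) [NeZero m] [NeZero n] (Ω : Type*) [MeasurableSpace Ω]
      (μ : Measure Ω) [IsProbabilityMeasure μ] (A : Ω → Matrix (Fin m) (Fin n) ℝ),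
      IsIIDSubGaussianMatrix A μ → ∀ N : ℝ, 1 ≤ N →
      orliczNorm 2 (fun ω => A ω 0 0) μ < ENNReal.ofReal N → ∀ x y : EuclideanSpace ℝ (Fin n),
      orliczNorm 2 (fun ω => processR p A μ x ω - processR p A μ y ω) μ ≤
        ENNReal.ofReal (C * N ^ (4 * p + 4) * (m : ℝ) ^ (1 / p - 1 / max p 2) * ‖x - y‖) := by
  obtain ⟨C, hC, hmain⟩ := exists_measure_processR_le p hp
  refine ⟨√(2 * (2 * C + 1)) * (3 * C), by positivity, ?_⟩
  intro m n _ _ Ω _ μ _ A hA N hN hKN x y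
  have hm : 0 < (m : ℝ) := by exact_mod_cast Nat.pos_of_ne_zero (NeZero.ne m)
  rcases eq_or_ne x y with rfl | hxy
  · simp only [sub_self]
    rw [orliczNorm_two_zero]
    exact zero_le
  have hd : 0 < ‖x - y‖ := norm_pos_iff.2 (sub_ne_zero.2 hxy)
  obtain ⟨e, he, hxe⟩ := exists_norm_eq_one_smul_eq x
  obtain ⟨f, hf, hyf⟩ := exists_norm_eq_one_smul_eq y
  set ρ := (m : ℝ) ^ (1 / p - 1 / max p 2) with hρ
  have hρ0 : 0 < ρ := by positivity
  set r := N ^ (4 * p + 4) with hr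
  have hr0 : 0 < r := by positivity
  have hnorm : |‖x‖ - ‖y‖| ≤ ‖x - y‖ := abs_norm_sub_norm_le x y
  have hef : ‖y‖ * ‖e - f‖ ≤ 2 * ‖x - y‖ := by
    have h1 : ‖y‖ • (e - f) = (x - y) - (‖x‖ - ‖y‖) • e := by
      rw [smul_sub, sub_smul, ← hxe, ← hyf]; abel
    have h2 : ‖y‖ * ‖e - f‖ = ‖‖y‖ • (e - f)‖ := by rw [norm_smul, norm_norm]
    rw [h2, h1]
    refine (norm_sub_le _ _).trans ?_
    rw [norm_smul, he, mul_one, Real.norm_eq_abs]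
    linarith
  -- The angular part costs `‖y‖ * ‖e - f‖ ≤ 2 * ‖x - y‖` and the radial part `|‖x‖ - ‖y‖| ≤ ‖x -
  -- y‖`, whence the factor `3` in `τ`.
  have hdec : ∀ ω, processR p A μ x ω - processR p A μ y ω =
      ‖y‖ * (processR p A μ e ω - processR p A μ f ω) + (‖x‖ - ‖y‖) * processR p A μ e ω := by
    intro ω
    have h1 : processR p A μ x ω = ‖x‖ * processR p A μ e ω := by
      conv_lhs => rw [hxe]
      exact processR_smul hp (norm_nonneg x) e ω
    have h2 : processR p A μ y ω = ‖y‖ * processR p A μ f ω := by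
      conv_lhs => rw [hyf]
      exact processR_smul hp (norm_nonneg y) f ω
    rw [h1, h2]; ring
  have hmeas : Measurable fun ω => processR p A μ x ω - processR p A μ y ω :=
    ((measurable_ellNorm_mulVec hp hA x).sub_const _).sub
      ((measurable_ellNorm_mulVec hp hA y).sub_const _)
  have h := orliczNorm_two_le_of_tail (μ := μ) hmeas (C := 2 * C) (τ := 3 * C * r * ρ * ‖x - y‖)
    (by positivity) (by positivity) ?_
  · refine h.trans_eq ?_
    congr 1; ring
  intro t ht0
  -- For `t ≤ 1` the claim is trivial: `2 * C * exp (-(t ^ 2 / 2)) ≥ 1`. This is why the tail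
  -- constant is doubled.
  rcases le_total t 1 with ht | ht
  · have h1 : (1 : ℝ) / 2 ≤ Real.exp (-(t ^ 2 / 2)) := by
      have := Real.add_one_le_exp (-(t ^ 2 / 2))
      nlinarith
    refine (measureReal_le_one (μ := μ)).trans ?_
    nlinarith
  refine (measureReal_mono ?_).trans ((hmain m n Ω μ A hA N hN hKN e f he hf t ht).trans ?_)
  · intro ω hω
    simp only [Set.mem_ofPred_eq] at hω ⊢
    by_contra! hcon
    obtain ⟨h1, h2⟩ := hcon
    rw [hdec] at hω
    refine absurd hω (not_lt.2 ?_)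
    calc _ ≤ ‖y‖ * |processR p A μ e ω - processR p A μ f ω| +
          |‖x‖ - ‖y‖| * |processR p A μ e ω| := by
          refine (abs_add_le _ _).trans ?_
          rw [abs_mul, abs_mul, abs_norm]
      _ ≤ ‖y‖ * (C * ‖e - f‖ * ρ * r * t) + ‖x - y‖ * (C * ρ * r * t) := by gcongr
      _ = ‖y‖ * ‖e - f‖ * (C * ρ * r * t) + ‖x - y‖ * (C * ρ * r * t) := by ring
      _ ≤ 2 * ‖x - y‖ * (C * ρ * r * t) + ‖x - y‖ * (C * ρ * r * t) := by gcongr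
      _ = _ := by ring
  · gcongr
    linarith

end Increments

/-! ### Conclusion. -/

theorem theorem3p5 (p : ℝ) (hp : 1 ≤ p) (q : ℝ≥0∞)
    (hpq : ENNReal.HolderConjugate (ENNReal.ofReal p) q) :
    ∃ C : ℝ, 0 < C ∧
      ∀ (m n : ℕ) [NeZero m] [NeZero n] (Ω : Type*) [MeasurableSpace Ω]
        (μ : Measure Ω) [IsProbabilityMeasure μ] (A : Ω → Matrix (Fin m) (Fin n) ℝ),
        IsIIDSubGaussianMatrix A μ →
        ∀ x y : EuclideanSpace ℝ (Fin n),
          orliczNorm 2 (fun ω => processR p A μ x ω - processR p A μ y ω) μ ≤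
              ENNReal.ofReal C * orliczNorm 2 (fun ω => A ω 0 0) μ ^ (4 * p + 4) *
                rad (ellBall m q) * ENNReal.ofReal ‖x - y‖ ∧
          orliczNorm 2 (fun ω => processX p A μ x ω - processX p A μ y ω) μ ≤
              ENNReal.ofReal C * orliczNorm 2 (fun ω => A ω 0 0) μ ^ (4 * p + 4) *
                rad (ellBall m q) * ENNReal.ofReal ‖x - y‖ := by
  obtain ⟨C, hC, hmain⟩ := exists_orliczNorm_processR_sub_le p hp
  -- The `3` is the cost of centring; `2 ^ (4 * p + 4)` comes from `N = 2 * K`, which meets the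
  -- strict inequality `K < N`.
  refine ⟨3 * (C * 2 ^ (4 * p + 4)), by positivity, ?_⟩
  intro m n _ _ Ω _ μ _ A hA x y
  set K := orliczNorm 2 (fun ω => A ω 0 0) μ with hK
  have hKtop : K ≠ ∞ := (hA.subGaussian 0 0).ne
  have hK1 : 1 ≤ K := one_le_orliczNorm_two (hA.measurable_entry 0 0) (hA.integral_sq_entry 0 0)
  have hKr : 1 ≤ K.toReal := by
    rw [← ENNReal.toReal_one]
    exact ENNReal.toReal_mono hKtop hK1
  have hN1 : 1 ≤ 2 * K.toReal := by linarith
  have hKN : K < ENNReal.ofReal (2 * K.toReal) := by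
    rw [ENNReal.lt_ofReal_iff_toReal_lt hKtop]; linarith
  have hbase := hmain m n Ω μ A hA (2 * K.toReal) hN1 hKN x y
  set W := ENNReal.ofReal (C * 2 ^ (4 * p + 4)) * K ^ (4 * p + 4) * rad (ellBall m q) *
    ENNReal.ofReal ‖x - y‖ with hW
  have hR : orliczNorm 2 (fun ω => processR p A μ x ω - processR p A μ y ω) μ ≤ W := by
    refine hbase.trans ?_
    have h1 : K ^ (4 * p + 4) = ENNReal.ofReal (K.toReal ^ (4 * p + 4)) := by
      rw [← ENNReal.ofReal_rpow_of_nonneg ENNReal.toReal_nonneg (by linarith),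
        ENNReal.ofReal_toReal hKtop]
    rw [hW, h1, Real.mul_rpow zero_le_two ENNReal.toReal_nonneg, ← mul_assoc C,
      ENNReal.ofReal_mul (by positivity), ENNReal.ofReal_mul (by positivity),
      ENNReal.ofReal_mul (by positivity)]
    gcongr
    exact ofReal_rpow_le_rad_ellBall hp hpq m
  have h3W : ENNReal.ofReal (3 * (C * 2 ^ (4 * p + 4))) * K ^ (4 * p + 4) * rad (ellBall m q) *
      ENNReal.ofReal ‖x - y‖ = 3 * W := by
    rw [hW, ENNReal.ofReal_mul (by norm_num), ENNReal.ofReal_ofNat]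
    ring
  rw [h3W]
  refine ⟨hR.trans (le_mul_of_one_le_left zero_le (by norm_num)), ?_⟩
  have hint := integrable_ellNorm_mulVec hp hA (by linarith) hKN
  have hRint : ∀ z, Integrable (processR p A μ z) μ := fun z =>
    (hint z).sub (integrable_const _)
  -- The two processes differ by a deterministic function of the vector, which centring removes.
  have hX : (fun ω => processX p A μ x ω - processX p A μ y ω) = fun ω =>
      (processR p A μ x ω - processR p A μ y ω) -
        ∫ ω', (processR p A μ x ω' - processR p A μ y ω') ∂μ := by
    have h1 : ∀ z, ∫ ω, processR p A μ z ω ∂μ =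
        (∫ ω, ellNorm (ENNReal.ofReal p) (A ω *ᵥ z.ofLp) ∂μ) -
          (m : ℝ) ^ (1 / p) * rowNorm p A μ z := by
      intro z
      simp only [processR]
      rw [integral_sub (hint z) (integrable_const _)]
      simp
    ext ω
    rw [integral_sub (hRint x) (hRint y), h1, h1]
    simp only [processR, processX]
    ring
  rw [hX]
  exact orliczNorm_two_sub_integral_le.trans (by gcongr)
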